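/- For $n\ge 1$ and $m\ge 0$, the mean-field zero-range process with $n$ sites and $m$ particles is the continuous-time Markov chain $\eta(t)=(\eta_1(t),\dots,\eta_n(t))$ (with right-continuous paths) on $\{\eta\in\mathbb Z_+^n:\eta_1+\dots+\eta_n=m\}$ with transition semigroup $P_t=e^{t\mathcal L}$, where $$(\mathcal L f)(\eta)=\frac1n\sum_{1\le i,j\le n}\mathbf 1_{(\eta_i>0)}\bigl(f(\eta+\delta^j-\delta^i)-f(\eta)\bigr).$$ Consider a sequence of such processes with deterministic initial configurations, such that $n\to\infty$, $m/n\to\rho\in(0,\infty)$, and such that the initial empirical distribution $Q(0)=\frac1n\sum_{i=1}^n\delta_{\eta_i(0)}$ converges in $\ell^1(\mathbb Z_+)$ to some probability distribution $q$ on $\mathbb Z_+$. Let $W(t)=\frac1n\sum_{i=1}^n\delta_{(\eta_i(0),\eta_i(t))}$ be the empirical transition matrix. Then there is a unique path $(\mathfrak q(t))_{t\ge0}$ of probability distributions on $\mathbb Z_+$ with $\mathfrak q(0)=q$ and, for all $k\ge 0$ and $t\ge 0$, $$\frac{d\mathfrak q_k}{dt}=\mathfrak q_{k+1}-\mathfrak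 q_k\mathbf 1_{(k\ge1)}-\Bigl(\sum_{\ell\ge1}\mathfrak q_\ell\Bigr)\bigl(\mathfrak q_k-\mathfrak q_{k-1}\mathbf 1_{(k\ge1)}\bigr).$$ Let $\Xi^+,\Xi^-$ be independent Poisson point processes of unit intensity on $\mathbb R_+$, with $\Xi^\pm(t)$ the number of points in $[0,t]$, let $X(0)$ be a $q$-distributed variable independent of $(\Xi^+,\Xi^-)$, and set $$Z(t)=\Xi^+\Bigl(\int_0^t(1-\mathfrak q_0(s))\,ds\Bigr)-\Xi^-(t),\qquad X(t)=\bigl(X(0)+Z(t)\bigr)\vee\max_{s\in[0,t]}\bigl(Z(t)-Z(s)\bigr).$$ Then, with $w_{k,\ell}(t)=\mathbb P(X(0)=k,\,X(t)=\ell)$ and $\|w\|=\sum_{k,\ell\ge 0}|w_{k,\ell}|$, for every $T\ge0$, $$\sup_{t\in[0,T]}\|W(t)-w(t)\|\longrightarrow 0\quad\text{in probability.}$$ -/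

import Mathlib

open MeasureTheory ProbabilityTheory Filter Topology
open scoped NNReal ENNReal BigOperators

namespace ZeroRange

noncomputable section

/-! ### The mean-field zero-range process -/

/-- The state space: arrangements of `m` indistinguishable particles on `n` sites. -/
def Config (n m : ℕ) : Type := {η : Fin n → ℕ // ∑ i, η i = m}

instance (n m : ℕ) : Fintype (Config n m) :=
  Fintype.subtype (Finset.piAntidiag (Finset.univ : Finset (Fin n)) m)
    (fun η => by simp [Finset.mem_piAntidiag])

/-- Every subset of the finite state space is measurable. -/
instance (n m : ℕ) : MeasurableSpace (Config n m) := ⊤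

/-- The configuration `η + δ^j - δ^i`, obtained from `η` by moving a particle from the non-empty
site `i` to the site `j` (which may be equal to `i`). -/
def Config.move {n m : ℕ} (η : Config n m) (i j : Fin n) (h : 0 < η.1 i) : Config n m :=
  ⟨fun k => η.1 k + Pi.single (M := fun _ => ℕ) j 1 k - Pi.single (M := fun _ => ℕ) i 1 k, by
    have hle : ∀ k ∈ (Finset.univ : Finset (Fin n)), Pi.single (M := fun _ => ℕ) i 1 k ≤
        η.1 k + Pi.single (M := fun _ => ℕ) j 1 k := by
      intro k _
      by_cases hk : k = i
      · subst hk
        simp only [Pi.single_eq_same]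
        omega
      · simp [Pi.single_eq_of_ne hk]
    rw [Finset.sum_tsub_distrib _ hle, Finset.sum_add_distrib, η.2]
    simp⟩

/-- The generator of the unit-rate zero-range process on the complete graph:
`(L f)(η) = (1/n) ∑_{i,j} 1_{η_i > 0} (f (η + δ^j - δ^i) - f η)`. -/
def generator (n m : ℕ) : (Config n m → ℝ) →L[ℝ] (Config n m → ℝ) :=
  LinearMap.toContinuousLinearMap
    { toFun := fun f η => (1 / (n : ℝ)) *
        ∑ i : Fin n, ∑ j : Fin n, if h : 0 < η.1 i then f (η.move i j h) - f η else 0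
      map_add' := by
        intro f g
        funext η
        simp only [Pi.add_apply, ← mul_add, ← Finset.sum_add_distrib]
        congr 1
        refine Finset.sum_congr rfl fun i _ => Finset.sum_congr rfl fun j _ => ?_
        split_ifs
        · ring
        · simp
      map_smul' := by
        intro c f
        funext η
        simp only [Pi.smul_apply, smul_eq_mul, RingHom.id_apply, Finset.mul_sum]
        refine Finset.sum_congr rfl fun i _ => Finset.sum_congr rfl fun j _ => ?_
        split_ifs
        · ring
        · simp }

/-- The transition semigroup `P_t = exp (t L)`. -/
def semigroup (n m : ℕ) (t : ℝ≥0) : (Config n m → ℝ) →L[ℝ] (Config n m → ℝ) :=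
  NormedSpace.exp ((t : ℝ) • generator n m)

/-- `η` is a (right-continuous) zero-range process with `n` sites and `m` particles, started from
the configuration `η₀`: a Markov process with transition semigroup `P_t = exp (t L)`, with respect
to its natural filtration. -/
structure IsZeroRangeProcess {Ω : Type*} [MeasurableSpace Ω] (P : Measure Ω) {n m : ℕ}
    (η : ℝ≥0 → Ω → Config n m) (η₀ : Config n m) : Prop where
  measurable : ∀ t, Measurable (η t)
  /-- Paths are right-continuous for the discrete topology of the state space. -/
  right_continuous : ∀ ω t, ∀ᶠ s in 𝓝[≥] t, η s ω = η t ω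
  initial : ∀ᵐ ω ∂P, η 0 ω = η₀
  markov : ∀ s t : ℝ≥0, s ≤ t → ∀ f : Config n m → ℝ,
    P[fun ω => f (η t ω) | ⨆ u : Set.Iic s, MeasurableSpace.comap (η u) inferInstance]
      =ᵐ[P] fun ω => semigroup n m (t - s) f (η s ω)

/-! ### Empirical quantities -/

/-- The empirical distribution `(1/n) ∑_i δ_{x_i}` of a finite family. -/
def empirical {α : Type*} [DecidableEq α] {n : ℕ} (x : Fin n → α) : α → ℝ :=
  (1 / (n : ℝ)) • ∑ i, Pi.single (x i) (1 : ℝ)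

/-- The empirical transition matrix `(1/n) ∑_i δ_{(η_i(0), η_i(t))}`. -/
def transitionMatrix {n m : ℕ} (η η' : Config n m) : ℕ × ℕ → ℝ :=
  empirical fun i => (η.1 i, η'.1 i)

/-- The `ℓ¹` distance `∑_a |x_a - y_a|`. -/
def l1dist {α : Type*} (x y : α → ℝ) : ℝ≥0∞ := ∑' a, ‖x a - y a‖ₑ

/-! ### The fluid limit -/

/-- `q` is a probability distribution on the non-negative integers. -/
def IsProb (q : ℕ → ℝ) : Prop := (∀ k, 0 ≤ q k) ∧ HasSum q 1

/-- The drift `F_k(q) = q_{k+1} - q_k 1_{k ≥ 1} - (∑_{l ≥ 1} q_l) (q_k - q_{k-1} 1_{k ≥ 1})`. -/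
def fluidDrift (q : ℕ → ℝ) (k : ℕ) : ℝ :=
  q (k + 1) - (if 1 ≤ k then q k else 0)
    - (∑' l, q (l + 1)) * (q k - if 1 ≤ k then q (k - 1) else 0)

/-- `𝔮` is a solution on `[0, ∞)`, with values in the probability distributions on the
non-negative integers, of `d𝔮_k/dt = F_k(𝔮)` for all `k`, with `𝔮(0) = q`. -/
structure IsFluidSolution (q : ℕ → ℝ) (𝔮 : ℝ → ℕ → ℝ) : Prop where
  isProb : ∀ t, 0 ≤ t → IsProb (𝔮 t)
  initial : 𝔮 0 = q
  deriv : ∀ k t, 0 ≤ t →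
    HasDerivWithinAt (fun s => 𝔮 s k) (fluidDrift (𝔮 t) k) (Set.Ici 0) t

/-! ### The fluid birth-and-death process -/

/-- `N t` is the number of points in `[0, t]` of a Poisson point process of unit intensity on
`[0, ∞)`. -/
structure IsUnitPoissonProcess {Ω : Type*} [MeasurableSpace Ω] (P : Measure Ω)
    (N : ℝ≥0 → Ω → ℕ) : Prop where
  measurable : ∀ t, Measurable (N t)
  zero : ∀ ω, N 0 ω = 0
  monotone : ∀ ω, Monotone fun t => N t ω
  right_continuous : ∀ ω t, ∀ᶠ s in 𝓝[≥] t, N s ω = N t ω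
  indep_increments : HasIndepIncrements N P
  law_increments : ∀ s t : ℝ≥0, s ≤ t →
    P.map (fun ω => N t ω - N s ω) = poissonMeasure (t - s)

/-- `Z(t) = Ξ⁺(∫_0^t (1 - 𝔮_0(s)) ds) - Ξ⁻(t)`. -/
def fluidInput {Ω : Type*} (𝔮 : ℝ → ℕ → ℝ) (Ξp Ξm : ℝ≥0 → Ω → ℕ) (t : ℝ≥0) (ω : Ω) : ℤ :=
  (Ξp (∫ s in (0 : ℝ)..t, (1 - 𝔮 s 0)).toNNReal ω : ℤ) - (Ξm t ω : ℤ)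

/-- The reflected process `X(t) = (X(0) + Z(t)) ∨ max_{s ∈ [0, t]} (Z(t) - Z(s))`. -/
def fluidProcess {Ω : Type*} (𝔮 : ℝ → ℕ → ℝ) (Ξp Ξm : ℝ≥0 → Ω → ℕ) (X₀ : Ω → ℕ)
    (t : ℝ≥0) (ω : Ω) : ℤ :=
  max ((X₀ ω : ℤ) + fluidInput 𝔮 Ξp Ξm t ω)
    (sSup ((fun s => fluidInput 𝔮 Ξp Ξm t ω - fluidInput 𝔮 Ξp Ξm s ω) '' Set.Icc 0 t))

/-- `w_{k,l}(t) = ℙ(X(0) = k, X(t) = l)`, for an integer-valued process `X`. -/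
def jointLaw {Ω : Type*} [MeasurableSpace Ω] (P : Measure Ω) (X : ℝ≥0 → Ω → ℤ)
    (t : ℝ≥0) (kl : ℕ × ℕ) : ℝ :=
  P.real {ω | X 0 ω = (kl.1 : ℤ) ∧ X t ω = (kl.2 : ℤ)}

end

end ZeroRange

/-! Give each site a label, either its initial occupation or nothing, and view the empirical
distribution V of (label, current occupation) as a vector of ℓ². A jump i → j with i ≠ j changes V
by 1/n times a death at i plus a birth at j. Averaged over all jumps, V moves along `drift (1 -
emptyFraction x) V`, where `drift c` is the forward operator of the chain with birth rate c and
death rate one; self-jumps and second-order terms cost O(1/n) in the squared distance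
(`generator_norm_sq_le`).

The fluid objects obey the same equation with c = 1 - 𝔮₀: without labels this is the equation of 𝔮,
and with label X(0) it is that of w, because over a short interval the Poisson processes propose
independently of the past at most one birth or death, and reflection suppresses a death at zero
(`norm_fluidLaw_sub_sub_le`). The law of X(t) need not be identified with 𝔮(t).

Shifts are contractions of ℓ², so all operators are bounded, and squared norms expand exactly. With
Q the unlabelled empirical profile, D = ‖W - w‖² + ‖Q - 𝔮‖² satisfies (∂_t + L) D ≤ 14 D + 64/n
(`discrepancy_add_generator_le`, in one-step form with O(h²) error): the mismatch of birth rates is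
a coordinate of Q - 𝔮, so the pair closes. A Doob-type inequality (`IsZeroRangeProcess.maximal`)
then gives a · P(sup D > a) ≤ exp(14 T) (D(0) + 64 T / n), and D(0) is controlled by the ℓ¹ distance
at time zero.

Small ℓ² distance becomes small ℓ¹ distance by Scheffé's lemma and the tightness of w(t), uniform on
[0, T] (`exists_l1dist_le`). The fluid equation itself is a locally Lipschitz equation in ℓ², solved
by `exists_fluid_curve`. -/

namespace ZeroRange

noncomputable section

section

/-! ### The Hilbert space of square-summable labelled occupation profiles -/

/-- Square-summable families indexed by a label and an occupation number. -/
abbrev Profile (α : Type*) := lp (fun _ : α × ℕ => ℝ) 2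

variable {α : Type*}

lemma two_toReal_pos : (0 : ℝ) < (2 : ℝ≥0∞).toReal := by norm_num

lemma Profile.sum_sq_le (v : Profile α) (s : Finset (α × ℕ)) : ∑ x ∈ s, v x ^ 2 ≤ ‖v‖ ^ 2 := by
  have := lp.sum_rpow_le_norm_rpow two_toReal_pos v s
  simpa [Real.norm_eq_abs] using this

lemma Profile.abs_apply_le (v : Profile α) (x : α × ℕ) : |v x| ≤ ‖v‖ :=
  lp.norm_apply_le_norm (by norm_num) v x

lemma Profile.norm_le_of_sum_sq_le {v : Profile α} {C : ℝ} (hC : 0 ≤ C)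
    (h : ∀ s : Finset (α × ℕ), ∑ x ∈ s, v x ^ 2 ≤ C ^ 2) : ‖v‖ ≤ C :=
  lp.norm_le_of_forall_sum_le two_toReal_pos hC fun s => by
    simpa [Real.norm_eq_abs] using h s

lemma Profile.norm_le_of_sum_abs_le {v : Profile α} {C : ℝ}
    (h : ∀ s : Finset (α × ℕ), ∑ x ∈ s, |v x| ≤ C) : ‖v‖ ≤ C := by
  refine Profile.norm_le_of_sum_sq_le (by simpa using h ∅) fun s => ?_
  calc ∑ x ∈ s, v x ^ 2 = ∑ x ∈ s, |v x| ^ 2 := by simp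
    _ ≤ (∑ x ∈ s, |v x|) ^ 2 := Finset.sum_sq_le_sq_sum_of_nonneg fun _ _ => abs_nonneg _
    _ ≤ C ^ 2 := by
      gcongr
      exact h s

lemma memℓp_two_of_sum_le {f : α × ℕ → ℝ} {C : ℝ}
    (h : ∀ s : Finset (α × ℕ), ∑ x ∈ s, |f x| ≤ C) : Memℓp f 2 := by
  have h1 : Memℓp f 1 := memℓp_gen' (C := C) fun s => by simpa using h s
  exact h1.of_exponent_ge (by norm_num)

/-- The profile with given absolutely summable coordinates. -/
def Profile.mk (f : α × ℕ → ℝ) (C : ℝ) (h : ∀ s : Finset (α × ℕ), ∑ x ∈ s, |f x| ≤ C) :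
    Profile α :=
  ⟨f, memℓp_two_of_sum_le h⟩

/-! ### Shifts, birth and death as bounded operators on ℓ². -/

/-- The shift `(S v)(a, l) = v(a, l + 1)`. -/
def shiftDown (α : Type*) : Profile α →L[ℝ] Profile α :=
  LinearMap.mkContinuous
    { toFun := fun v => ⟨fun x => v (x.1, x.2 + 1), memℓp_gen (by
        have := (lp.memℓp v).summable two_toReal_pos
        exact this.comp_injective (i := fun x : α × ℕ => (x.1, x.2 + 1)) fun x y hxy => by
          simp only [Prod.mk.injEq, add_left_inj] at hxy
          exact Prod.ext hxy.1 hxy.2)⟩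
      map_add' := fun _ _ => rfl
      map_smul' := fun _ _ => rfl } 1 fun v => by
    rw [one_mul]
    refine Profile.norm_le_of_sum_sq_le (norm_nonneg _) fun s => ?_
    classical
    have := Profile.sum_sq_le v (s.map ⟨fun x : α × ℕ => (x.1, x.2 + 1), fun x y hxy => by
          simp only [Prod.mk.injEq, add_left_inj] at hxy
          exact Prod.ext hxy.1 hxy.2⟩)
    rw [Finset.sum_map] at this
    exact this

@[simp]
lemma shiftDown_apply (v : Profile α) (a : α) (l : ℕ) : shiftDown α v (a, l) = v (a, l + 1) := rfl

lemma norm_shiftDown_le : ‖shiftDown α‖ ≤ 1 := LinearMap.mkContinuous_norm_le _ zero_le_one _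

/-- The adjoint shift `(S† v)(a, l) = v(a, l - 1) 1_{l ≥ 1}`. -/
def shiftUp (α : Type*) : Profile α →L[ℝ] Profile α := (shiftDown α).adjoint

lemma norm_shiftUp_le : ‖shiftUp α‖ ≤ 1 := by
  rw [shiftUp, LinearIsometryEquiv.norm_map]
  exact norm_shiftDown_le

/-- The unit point mass at `x`. -/
def point [DecidableEq α] (x : α × ℕ) : Profile α := lp.single 2 x (1 : ℝ)

section

variable [DecidableEq α]

lemma point_apply (x y : α × ℕ) : point x y = if y = x then 1 else 0 := by
  simp [point, Pi.single_apply]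

lemma norm_point (x : α × ℕ) : ‖point x‖ = 1 := by
  simp [point, lp.norm_single]

lemma inner_point (x : α × ℕ) (v : Profile α) : inner ℝ (point x) v = v x := by
  rw [point, lp.inner_single_left]
  simp

lemma shiftDown_point_succ (a : α) (l : ℕ) : shiftDown α (point (a, l + 1)) = point (a, l) := by
  ext ⟨b, k⟩
  simp [point_apply]

lemma shiftDown_point_zero (a : α) : shiftDown α (point (a, 0)) = 0 := by
  ext ⟨b, k⟩
  simp [point_apply]

end

lemma shiftUp_apply_succ (v : Profile α) (a : α) (l : ℕ) : shiftUp α v (a, l + 1) = v (a, l) := by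
  classical
  rw [← inner_point, shiftUp, ContinuousLinearMap.adjoint_inner_right, shiftDown_point_succ,
    inner_point]

lemma shiftUp_apply_zero (v : Profile α) (a : α) : shiftUp α v (a, 0) = 0 := by
  classical
  rw [← inner_point, shiftUp, ContinuousLinearMap.adjoint_inner_right, shiftDown_point_zero,
    inner_zero_left]

/-- Each positive occupation number decreases by one at rate one. -/
def death (α : Type*) : Profile α →L[ℝ] Profile α := shiftDown α - shiftUp α ∘L shiftDown α

/-- Each occupation number increases by one at rate one. -/
def birth (α : Type*) : Profile α →L[ℝ] Profile α := shiftUp α - ContinuousLinearMap.id ℝ _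

/-- S†S is the projection that erases level zero, so an empty site loses nothing. -/
lemma death_apply (v : Profile α) (a : α) (l : ℕ) :
    death α v (a, l) = v (a, l + 1) - if 1 ≤ l then v (a, l) else 0 := by
  cases l with
  | zero => simp [death, shiftUp_apply_zero]
  | succ l => simp [death, shiftUp_apply_succ]

lemma birth_apply (v : Profile α) (a : α) (l : ℕ) :
    birth α v (a, l) = (if 1 ≤ l then v (a, l - 1) else 0) - v (a, l) := by
  cases l with
  | zero => simp [birth, shiftUp_apply_zero]
  | succ l => simp [birth, shiftUp_apply_succ]

lemma norm_death_le (v : Profile α) : ‖death α v‖ ≤ 2 * ‖v‖ := by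
  have h1 : ‖shiftDown α v‖ ≤ ‖v‖ := by
    simpa using (shiftDown α).le_of_opNorm_le norm_shiftDown_le v
  have h2 : ‖shiftUp α (shiftDown α v)‖ ≤ ‖shiftDown α v‖ := by
    simpa using (shiftUp α).le_of_opNorm_le norm_shiftUp_le (shiftDown α v)
  have : ‖death α v‖ ≤ ‖shiftDown α v‖ + ‖shiftUp α (shiftDown α v)‖ := norm_sub_le _ _
  linarith

lemma norm_birth_le (v : Profile α) : ‖birth α v‖ ≤ 2 * ‖v‖ := by
  have h2 : ‖shiftUp α v‖ ≤ ‖v‖ := by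
    simpa using (shiftUp α).le_of_opNorm_le norm_shiftUp_le v
  have : ‖birth α v‖ ≤ ‖shiftUp α v‖ + ‖v‖ := norm_sub_le _ _
  linarith

section

variable [DecidableEq α]

lemma death_point_succ (a : α) (l : ℕ) :
    death α (point (a, l + 1)) = point (a, l) - point (a, l + 1) := by
  ext ⟨b, k⟩
  rw [death_apply, lp.coeFn_sub, Pi.sub_apply]
  simp only [point_apply, Prod.mk.injEq]
  grind

lemma death_point_zero (a : α) : death α (point (a, 0)) = 0 := by
  ext ⟨b, k⟩
  rw [death_apply]
  simp only [point_apply, Prod.mk.injEq, lp.coeFn_zero, Pi.zero_apply]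
  grind

lemma birth_point (a : α) (l : ℕ) :
    birth α (point (a, l)) = point (a, l + 1) - point (a, l) := by
  ext ⟨b, k⟩
  rw [birth_apply, lp.coeFn_sub, Pi.sub_apply]
  simp only [point_apply, Prod.mk.injEq]
  grind

end

/-- The forward operator of the birth-and-death dynamics with birth rate `c` and death rate one. -/
def drift (c : ℝ) (v : Profile α) : Profile α := death α v + c • birth α v

lemma norm_drift_le {c : ℝ} (hc : |c| ≤ 1) (v : Profile α) : ‖drift c v‖ ≤ 4 * ‖v‖ := by
  have h1 := norm_death_le v
  have h2 := norm_birth_le v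
  have h3 : ‖c • birth α v‖ ≤ 1 * (2 * ‖v‖) := by
    rw [norm_smul]
    gcongr
    exact hc
  have : ‖drift c v‖ ≤ ‖death α v‖ + ‖c • birth α v‖ := norm_add_le _ _
  linarith

lemma drift_sub_drift (c c' : ℝ) (v w : Profile α) :
    drift c v - drift c' w = drift c (v - w) + (c - c') • birth α w := by
  simp only [drift, map_sub, smul_sub, sub_smul]
  abel

lemma norm_drift_sub_drift_le {c c' : ℝ} (hc : |c| ≤ 1) (v : Profile α) {w : Profile α}
    (hw : ‖w‖ ≤ 1) : ‖drift c v - drift c' w‖ ≤ 4 * ‖v - w‖ + 2 * |c - c'| := by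
  rw [drift_sub_drift]
  have h1 := norm_drift_le hc (v - w)
  have h2 : ‖(c - c') • birth α w‖ ≤ |c - c'| * (2 * 1) := by
    rw [norm_smul]
    gcongr
    · exact le_rfl
    · exact (norm_birth_le w).trans (by gcongr)
  have := norm_add_le (drift c (v - w)) ((c - c') • birth α w)
  linarith

/-- A mean value inequality from coordinatewise derivatives. -/
lemma Profile.norm_sub_le_of_hasDerivWithinAt {x y : ℝ → Profile α} {s t C : ℝ} (hst : s ≤ t)
    (hx : ∀ i, ∀ u ∈ Set.Icc s t, HasDerivWithinAt (fun u => x u i) (y u i) (Set.Icc s t) u)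
    (hy : ∀ u ∈ Set.Icc s t, ‖y u‖ ≤ C) : ‖x t - x s‖ ≤ C * (t - s) := by
  classical
  have hC : 0 ≤ C := (norm_nonneg _).trans (hy s ⟨le_rfl, hst⟩)
  have key (z : Profile α) (F : Finset (α × ℕ)) :
      ‖∑ i ∈ F, lp.single (E := fun _ : α × ℕ => ℝ) 2 i (z i)‖ ^ 2 = ∑ i ∈ F, z i ^ 2 := by
    have := lp.norm_sum_single two_toReal_pos (fun i => z i) F
    simpa [Real.norm_eq_abs] using this
  refine Profile.norm_le_of_sum_sq_le (mul_nonneg hC (sub_nonneg.2 hst)) fun F => ?_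
  rw [← key]
  -- On finitely many coordinates, coordinatewise derivatives assemble into a derivative in norm;
  -- the resulting bound does not depend on `F`.
  have hd : ∀ u ∈ Set.Icc s t, HasDerivWithinAt
      (fun u => ∑ i ∈ F, lp.single (E := fun _ : α × ℕ => ℝ) 2 i (x u i))
      (∑ i ∈ F, lp.single (E := fun _ : α × ℕ => ℝ) 2 i (y u i)) (Set.Icc s t) u := by
    intro u hu
    refine HasDerivWithinAt.fun_sum fun i _ => ?_
    have h1 : ∀ c : ℝ, lp.single (E := fun _ : α × ℕ => ℝ) 2 i c = c • point i := by
      intro c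
      rw [point, ← lp.single_smul]
      simp
    simp only [h1]
    exact (hx i u hu).smul_const (point i)
  have hb : ∀ u ∈ Set.Icc s t,
      ‖∑ i ∈ F, lp.single (E := fun _ : α × ℕ => ℝ) 2 i (y u i)‖ ≤ C := by
    intro u hu
    refine le_of_sq_le_sq ?_ hC
    rw [key]
    exact (Profile.sum_sq_le _ _).trans (by gcongr; exact hy u hu)
  have := (convex_Icc s t).norm_image_sub_le_of_norm_hasDerivWithin_le hd hb
    (Set.left_mem_Icc.2 hst) (Set.right_mem_Icc.2 hst)
  rw [Real.norm_of_nonneg (sub_nonneg.2 hst)] at this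
  have h2 : ∑ i ∈ F, lp.single (E := fun _ : α × ℕ => ℝ) 2 i ((x t - x s) i) =
      ∑ i ∈ F, lp.single (E := fun _ : α × ℕ => ℝ) 2 i (x t i) -
      ∑ i ∈ F, lp.single (E := fun _ : α × ℕ => ℝ) 2 i (x s i) := by
    rw [← Finset.sum_sub_distrib]
    refine Finset.sum_congr rfl fun i _ => ?_
    rw [← lp.single_sub]
    rfl
  rw [h2]
  gcongr

end

section

variable {α : Type*}

lemma Profile.hasDerivWithinAt_apply {x : ℝ → Profile α} {y : Profile α} {s : Set ℝ} {t : ℝ}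
    (h : HasDerivWithinAt x y s t) (i : α × ℕ) : HasDerivWithinAt (fun u => x u i) (y i) s t := by
  classical
  have := (innerSL ℝ (point i)).hasFDerivAt.comp_hasDerivWithinAt t h
  simpa [Function.comp_def, inner_point] using this

lemma Profile.continuous_apply (i : α × ℕ) : Continuous fun v : Profile α => v i := by
  classical
  simp_rw [← inner_point i]
  fun_prop

/-- Makes the flux of mass through level K vanish as K → ∞, so that no mass escapes to infinity. -/
lemma Profile.tendsto_apply (v : Profile α) (a : α) :
    Tendsto (fun k => v (a, k)) atTop (𝓝 0) := by
  have h := (lp.memℓp v).summable two_toReal_pos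
  have h2 := (h.comp_injective (i := fun k : ℕ => (a, k)) fun _ _ h => (Prod.mk.inj h).2)
    |>.tendsto_atTop_zero
  have h3 : Tendsto (fun k => v (a, k) ^ 2) atTop (𝓝 0) := by
    simpa [Function.comp_def, Real.norm_eq_abs] using h2
  have h4 := (Real.continuous_sqrt.tendsto 0).comp h3
  simp only [Real.sqrt_zero, Function.comp_def, Real.sqrt_sq_eq_abs] at h4
  exact (tendsto_zero_iff_abs_tendsto_zero _).2 h4

/-! ### Clipping a profile to the nonnegative part of the unit ball -/

/-- The positive part of a profile. -/
def Profile.pos (v : Profile α) : Profile α :=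
  ⟨fun x => max (v x) 0, memℓp_gen (by
    refine Summable.of_nonneg_of_le (fun x => by positivity) (fun x => ?_)
      ((lp.memℓp v).summable two_toReal_pos)
    gcongr
    rw [Real.norm_eq_abs, Real.norm_eq_abs, abs_of_nonneg (le_max_right _ _)]
    exact max_le (le_abs_self _) (abs_nonneg _))⟩

lemma Profile.pos_apply (v : Profile α) (x : α × ℕ) : (Profile.pos v) x = max (v x) 0 := rfl

lemma Profile.norm_pos_le (v : Profile α) : ‖Profile.pos v‖ ≤ ‖v‖ :=
  lp.norm_mono (by norm_num) fun x => by
    rw [Profile.pos_apply, Real.norm_eq_abs, Real.norm_eq_abs, abs_of_nonneg (le_max_right _ _)]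
    exact max_le (le_abs_self _) (abs_nonneg _)

lemma Profile.norm_pos_sub_pos_le (v w : Profile α) : ‖Profile.pos v - Profile.pos w‖ ≤ ‖v - w‖ :=
  lp.norm_mono (by norm_num) fun x => by
    simp only [lp.coeFn_sub, Pi.sub_apply, Profile.pos_apply, Real.norm_eq_abs]
    exact abs_max_sub_max_le_abs _ _ _

/-- A map onto the nonnegative profiles of norm at most one, fixing each of them. -/
def Profile.clip (v : Profile α) : Profile α := (max 1 ‖v‖)⁻¹ • (Profile.pos v)

lemma Profile.clip_apply (v : Profile α) (x : α × ℕ) :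
    (Profile.clip v) x = (max 1 ‖v‖)⁻¹ * max (v x) 0 := rfl

lemma Profile.clip_nonneg (v : Profile α) (x : α × ℕ) : 0 ≤ (Profile.clip v) x := by
  rw [Profile.clip_apply]
  positivity

/-- This makes the clipped vector field point inwards wherever a coordinate is negative. -/
lemma Profile.clip_eq_zero {v : Profile α} {x : α × ℕ} (h : v x ≤ 0) : (Profile.clip v) x = 0 := by
  rw [Profile.clip_apply, max_eq_right h, mul_zero]

lemma Profile.clip_eq_self {v : Profile α} (h0 : ∀ x, 0 ≤ v x) (h1 : ‖v‖ ≤ 1) :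
    Profile.clip v = v := by
  ext x
  rw [Profile.clip_apply, max_eq_left h1, max_eq_left (h0 x), inv_one, one_mul]

lemma Profile.norm_clip_le (v : Profile α) : ‖Profile.clip v‖ ≤ 1 := by
  rw [Profile.clip, norm_smul, norm_inv, Real.norm_eq_abs, abs_of_nonneg (by positivity),
    inv_mul_le_one₀ (by positivity)]
  exact ((Profile.norm_pos_le v)).trans (le_max_right _ _)

/-- Both factors of the clip, the reciprocal of `max 1 ‖v‖` and the positive part, are 1-Lipschitz;
R enters as the size of the positive part of `w`. -/
lemma Profile.norm_clip_sub_clip_le {R : ℝ} (v : Profile α) {w : Profile α} (hw : ‖w‖ ≤ R) :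
    ‖Profile.clip v - Profile.clip w‖ ≤ (1 + R) * ‖v - w‖ := by
  set a := max 1 ‖v‖
  set b := max 1 ‖w‖
  have ha : 1 ≤ a := le_max_left _ _
  have hb : 1 ≤ b := le_max_left _ _
  have hab : |a⁻¹ - b⁻¹| ≤ ‖v - w‖ := by
    have h1 : |b - a| ≤ ‖v - w‖ := by
      have h2 : |b - a| ≤ |‖w‖ - ‖v‖| := by
        simpa only [max_comm] using abs_max_sub_max_le_abs ‖w‖ ‖v‖ 1
      refine h2.trans ?_
      rw [← norm_sub_rev]
      exact abs_norm_sub_norm_le w v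
    rw [inv_sub_inv (by positivity) (by positivity), abs_div, abs_of_pos
        (mul_pos (by positivity) (by positivity) : 0 < a * b)]
    exact (div_le_self (abs_nonneg _) (one_le_mul_of_one_le_of_one_le ha hb)).trans h1
  have heq : Profile.clip v - Profile.clip w = a⁻¹ • (Profile.pos v - Profile.pos w) +
      (a⁻¹ - b⁻¹) • (Profile.pos w) := by
    simp only [Profile.clip, smul_sub, sub_smul, a, b]
    abel
  rw [heq]
  have e1 : ‖a⁻¹ • (Profile.pos v - Profile.pos w)‖ ≤ 1 * ‖v - w‖ := by
    rw [norm_smul, norm_inv, Real.norm_eq_abs, abs_of_nonneg (by positivity)]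
    gcongr
    · exact inv_le_one_of_one_le₀ ha
    · exact Profile.norm_pos_sub_pos_le v w
  have e2 : ‖(a⁻¹ - b⁻¹) • (Profile.pos w)‖ ≤ ‖v - w‖ * R := by
    rw [norm_smul]
    gcongr
    · exact hab
    · exact (Profile.norm_pos_le w).trans hw
  linarith [norm_add_le (a⁻¹ • (Profile.pos v - Profile.pos w)) ((a⁻¹ - b⁻¹) • (Profile.pos w))]

/-! ### The fluid equation as an ordinary differential equation -/

/-- The vector field of the fluid equation. -/
def fluidField (v : Profile Unit) : Profile Unit := drift (1 - v ((), 0)) v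

lemma abs_one_sub_le {x : ℝ} (h0 : 0 ≤ x) (h1 : x ≤ 1) : |1 - x| ≤ 1 := by
  rw [abs_le]
  constructor <;> linarith

lemma Profile.abs_one_sub_apply_le {v : Profile α} {x : α × ℕ} (h0 : 0 ≤ v x) (h1 : ‖v‖ ≤ 1) :
    |1 - v x| ≤ 1 :=
  abs_one_sub_le h0 ((le_abs_self _).trans (((Profile.abs_apply_le v) x).trans h1))

lemma norm_fluidField_le {v : Profile Unit} (h0 : 0 ≤ v ((), 0)) (h1 : ‖v‖ ≤ 1) :
    ‖fluidField v‖ ≤ 4 := by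
  have := norm_drift_le (Profile.abs_one_sub_apply_le h0 h1) v
  rw [fluidField]
  linarith

lemma norm_fluidField_sub_le {v w : Profile Unit} (hv0 : 0 ≤ v ((), 0)) (hv : ‖v‖ ≤ 1)
    (hw : ‖w‖ ≤ 1) : ‖fluidField v - fluidField w‖ ≤ 6 * ‖v - w‖ := by
  have := norm_drift_sub_drift_le (c' := 1 - w ((), 0))
    (Profile.abs_one_sub_apply_le hv0 hv) v hw
  have h2 : |1 - v ((), 0) - (1 - w ((), 0))| ≤ ‖v - w‖ := by
    rw [show 1 - v ((), 0) - (1 - w ((), 0)) = -((v - w) ((), 0)) by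
      rw [lp.coeFn_sub, Pi.sub_apply]; ring, abs_neg]
    exact Profile.abs_apply_le _ _
  rw [fluidField, fluidField]
  linarith

/-- The sum telescopes: births and deaths below level K cancel, leaving the flux across the edge {K,
K + 1}. This yields conservation of mass. -/
lemma sum_drift (c : ℝ) (v : Profile α) (a : α) (K : ℕ) :
    ∑ k ∈ Finset.range (K + 1), drift c v (a, k) = v (a, K + 1) - c * v (a, K) := by
  have key (k : ℕ) : drift c v (a, k) = (v (a, k + 1) - if 1 ≤ k then v (a, k) else 0) +
      c * ((if 1 ≤ k then v (a, k - 1) else 0) - v (a, k)) := by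
    rw [← death_apply, ← birth_apply]
    rfl
  induction K with
  | zero =>
    rw [zero_add, Finset.sum_range_one, key]
    simp
    ring
  | succ K ih =>
    rw [Finset.sum_range_succ, ih, key]
    simp
    ring

/-- The profile of a probability distribution. -/
def toProfile (p : ℕ → ℝ) : Profile Unit :=
  -- Only the values at probability distributions matter; these are always square summable.
  open Classical in if h : Memℓp (fun x : Unit × ℕ => p x.2) 2 then ⟨_, h⟩ else 0

lemma IsProb.sum_abs_le {p : ℕ → ℝ} (hp : IsProb p) (s : Finset (Unit × ℕ)) :
    ∑ x ∈ s, |p x.2| ≤ 1 := by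
  have h1 : ∑ x ∈ s, |p x.2| = ∑ k ∈ s.map (Equiv.punitProd ℕ).toEmbedding, p k := by
    rw [Finset.sum_map]
    exact Finset.sum_congr rfl fun x _ => abs_of_nonneg (hp.1 _)
  rw [h1]
  exact sum_le_hasSum _ (fun i _ => hp.1 i) hp.2

lemma toProfile_apply {p : ℕ → ℝ} (hp : IsProb p) (x : Unit × ℕ) : toProfile p x = p x.2 := by
  rw [toProfile, dif_pos (memℓp_two_of_sum_le hp.sum_abs_le)]

lemma IsProb.norm_toProfile_le {p : ℕ → ℝ} (hp : IsProb p) : ‖toProfile p‖ ≤ 1 :=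
  Profile.norm_le_of_sum_abs_le fun s => by
    simp_rw [toProfile_apply hp]
    exact hp.sum_abs_le s

lemma IsProb.le_one {p : ℕ → ℝ} (hp : IsProb p) (k : ℕ) : p k ≤ 1 :=
  le_hasSum hp.2 k fun i _ => hp.1 i

/-- Total mass one turns the infinite sum over l ≥ 1 into 1 - p₀, a continuous function on ℓ². -/
lemma IsProb.fluidDrift_eq {p : ℕ → ℝ} (hp : IsProb p) (k : ℕ) :
    fluidDrift p k = fluidField (toProfile p) ((), k) := by
  have h : ∑' l, p (l + 1) = 1 - p 0 := by
    have := hp.2.summable.tsum_eq_zero_add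
    rw [hp.2.tsum_eq] at this
    linarith
  have h2 : fluidField (toProfile p) ((), k) =
      death Unit (toProfile p) ((), k) + (1 - toProfile p ((), 0)) *
        birth Unit (toProfile p) ((), k) := rfl
  rw [h2, death_apply, birth_apply, fluidDrift, h]
  simp only [toProfile_apply hp]
  ring

lemma lipschitzOnWith_fluidField_clip (R : ℝ≥0) :
    LipschitzOnWith (6 * (1 + R)) (fun v : Profile Unit => fluidField (Profile.clip v))
      (Metric.closedBall 0 R) := by
  refine LipschitzOnWith.of_dist_le_mul fun v _ w hw => ?_
  rw [dist_eq_norm, dist_eq_norm]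
  have h1 := norm_fluidField_sub_le ((Profile.clip_nonneg v) _) (Profile.norm_clip_le v)
      (Profile.norm_clip_le w)
  have h2 := Profile.norm_clip_sub_clip_le v (mem_closedBall_zero_iff.1 hw)
  push_cast
  linarith

/-- Barrier argument: where -f touches ε(1 + t), f is negative, so -f has slope at most 0 < ε and
cannot cross. -/
lemma nonneg_of_hasDerivWithinAt {f f' : ℝ → ℝ} {T : ℝ} (h0 : 0 ≤ f 0)
    (hf : ∀ t ∈ Set.Icc 0 T, HasDerivWithinAt f (f' t) (Set.Icc 0 T) t)
    (hf' : ∀ t ∈ Set.Icc 0 T, f t < 0 → 0 ≤ f' t) : ∀ t ∈ Set.Icc 0 T, 0 ≤ f t := by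
  intro t ht
  have key (ε : ℝ) (hε : 0 < ε) : -f t ≤ ε * (1 + t) := by
    refine image_le_of_deriv_right_lt_deriv_boundary (f := fun t => -f t) (f' := fun t => -f' t)
      (B := fun t => ε * (1 + t)) (B' := fun _ => ε) (a := 0) (b := T) ?_ ?_ ?_ ?_ ?_ ht
    · exact fun u hu => (hf u hu).continuousWithinAt.neg
    · intro u hu
      exact ((hf u ⟨hu.1, hu.2.le⟩).mono_of_mem_nhdsWithin
        (mem_of_superset (Icc_mem_nhdsGE hu.2) (Set.Icc_subset_Icc_left hu.1))).neg
    · simp only [add_zero, mul_one]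
      linarith
    · intro u
      simpa using ((hasDerivAt_id u).const_add 1).const_mul ε
    · intro u hu hfu
      have h1 : 0 < ε * (1 + u) := mul_pos hε (by linarith [hu.1])
      have := hf' u ⟨hu.1, hu.2.le⟩ (by linarith)
      linarith
  by_contra! hneg
  have h1 : 0 < 1 + t := by linarith [ht.1]
  -- This ε turns the bound into -f t ≤ -f t / 2.
  have := key (-f t / (2 * (1 + t))) (by apply div_pos <;> linarith)
  field_simp at this
  linarith

/-- The clipped field is bounded by 4 and Lipschitz on balls, so Picard–Lindelöf applies on the
whole of [0, T] at once. Positivity and conservation of mass then show that the clip was never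
active. -/
lemma exists_fluid_curve {q : ℕ → ℝ} (hq : IsProb q) {T : ℝ} (hT : 0 ≤ T) :
    ∃ x : ℝ → Profile Unit, x 0 = toProfile q ∧
      (∀ t ∈ Set.Icc 0 T, HasDerivWithinAt x (fluidField (x t)) (Set.Icc 0 T) t) ∧
      ∀ t ∈ Set.Icc 0 T, IsProb fun k => x t ((), k) := by
  obtain ⟨x, hx0, hx⟩ : ∃ x : ℝ → Profile Unit, x 0 = toProfile q ∧
      ∀ t ∈ Set.Icc 0 T, HasDerivWithinAt x (fluidField (Profile.clip (x t))) (Set.Icc 0 T) t := by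
    -- Speed 4 during time T stays within 4T of the starting point, which has norm at most 1; the
    -- Lipschitz constant is the one for the ball of radius 1 + 4T.
    have hPL : IsPicardLindelof (fun (_ : ℝ) (v : Profile Unit) => fluidField (Profile.clip v))
        (⟨0, le_rfl, hT⟩ : Set.Icc (0 : ℝ) T) (toProfile q) (4 * ⟨T, hT⟩) 0 4
        (6 * (1 + (1 + 4 * ⟨T, hT⟩))) := by
      refine ⟨fun t _ => (lipschitzOnWith_fluidField_clip _).mono ?_,
        fun v _ => continuousOn_const, fun t _ v _ => ?_, ?_⟩
      · intro v hv
        rw [mem_closedBall_zero_iff]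
        rw [mem_closedBall_iff_norm] at hv
        have := norm_le_norm_add_norm_sub' v (toProfile q)
        have h1 := hq.norm_toProfile_le
        push_cast at hv ⊢
        linarith
      · exact norm_fluidField_le ((Profile.clip_nonneg v) _) (Profile.norm_clip_le v)
      · simp only [sub_zero, NNReal.coe_zero]
        rw [max_eq_left (by linarith)]
        push_cast
        exact le_rfl
    exact hPL.exists_eq_forall_mem_Icc_hasDerivWithinAt₀
  have hnn : ∀ k, ∀ t ∈ Set.Icc 0 T, 0 ≤ x t ((), k) := by
    intro k
    refine nonneg_of_hasDerivWithinAt ?_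
      (fun t ht => Profile.hasDerivWithinAt_apply (hx t ht) ((), k)) ?_
    · rw [hx0, toProfile_apply hq]
      exact hq.1 k
    · intro t _ hneg
      set p := (Profile.clip (x t))
      -- With the k-th coordinate clipped to zero, only the nonnegative inflow from levels k ± 1
      -- remains.
      have hpk : p ((), k) = 0 := Profile.clip_eq_zero hneg.le
      have h2 : fluidField p ((), k) = death Unit p ((), k) + (1 - p ((), 0)) *
        birth Unit p ((), k) := rfl
      rw [h2, death_apply, birth_apply, hpk]
      have hp : ∀ y, 0 ≤ p y := fun y => Profile.clip_nonneg _ _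
      have hc : 0 ≤ 1 - p ((), 0) := by
        have := (le_abs_self _).trans
            (((Profile.abs_apply_le p) ((), 0)).trans (Profile.norm_clip_le (x t)))
        linarith
      have h3 : 0 ≤ if 1 ≤ k then p ((), k - 1) else 0 := by
        split_ifs
        · exact hp _
        · exact le_rfl
      have := mul_nonneg hc h3
      simp only [ite_self, sub_zero]
      linarith [hp ((), k + 1)]
  have hxc : ContinuousOn x (Set.Icc 0 T) := fun t ht => (hx t ht).continuousWithinAt
  have hclip : Continuous (Profile.clip : Profile Unit → Profile Unit) := by
    refine Continuous.smul (f := fun v : Profile Unit => (max 1 ‖v‖)⁻¹) (g := Profile.pos) ?_ ?_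
    · refine Continuous.inv₀ (by fun_prop) fun v => ?_
      have : (1 : ℝ) ≤ max 1 ‖v‖ := le_max_left _ _
      positivity
    · refine (LipschitzWith.of_dist_le_mul (K := 1) fun v w => ?_).continuous
      rw [dist_eq_norm, dist_eq_norm]
      simpa using Profile.norm_pos_sub_pos_le v w
  have hprob : ∀ t ∈ Set.Icc 0 T, IsProb fun k => x t ((), k) := by
    intro t ht
    refine ⟨fun k => hnn k t ht, ?_⟩
    rw [hasSum_iff_tendsto_nat_of_nonneg fun k => hnn k t ht, ← tendsto_add_atTop_iff_nat 1]
    -- The flux across {K, K + 1} is that of the clipped curve, which lies in the unit ball: it is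
    -- bounded by 2 and tends to 0 pointwise, so its time integral vanishes in the limit.
    set F : ℕ → ℝ → ℝ := fun K s =>
      (Profile.clip (x s)) ((), K + 1) - (1 - (Profile.clip (x s)) ((), 0)) *
          (Profile.clip (x s)) ((), K)
    have hFc (K : ℕ) : ContinuousOn (F K) (Set.Icc 0 t) := by
      have h (i : Unit × ℕ) : @ContinuousOn ℝ ℝ _ _ (fun s => (Profile.clip (x s)) i)
          (Set.Icc 0 t) :=
        ((Profile.continuous_apply i).comp hclip).comp_continuousOn
          (hxc.mono (Set.Icc_subset_Icc_right ht.2))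
      exact (h _).sub ((continuousOn_const.sub (h _)).mul (h _))
    have hint (K : ℕ) : ∫ s in (0 : ℝ)..t, F K s =
        ∑ k ∈ Finset.range (K + 1), x t ((), k) - ∑ k ∈ Finset.range (K + 1), x 0 ((), k) := by
      refine intervalIntegral.integral_eq_sub_of_hasDeriv_right_of_le
        (f := fun s => ∑ k ∈ Finset.range (K + 1), x s ((), k)) ht.1 ?_ ?_ ?_
      · exact continuousOn_finsetSum _ fun k _ => (Profile.continuous_apply _).comp_continuousOn
          (hxc.mono (Set.Icc_subset_Icc_right ht.2))
      · intro s hs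
        have hs' : s ∈ Set.Ico 0 T := ⟨hs.1.le, hs.2.trans_le ht.2⟩
        have hsum := HasDerivWithinAt.fun_sum (u := Finset.range (K + 1)) fun k _ =>
          Profile.hasDerivWithinAt_apply (hx s ⟨hs'.1, hs'.2.le⟩) ((), k)
        rw [fluidField, sum_drift] at hsum
        exact hsum.mono_of_mem_nhdsWithin (mem_of_superset (Icc_mem_nhdsGT hs'.2)
          (Set.Icc_subset_Icc_left hs'.1))
      · exact ((hFc K).mono (by rw [Set.uIcc_of_le ht.1])).intervalIntegrable
    have hlim : Tendsto (fun K => ∫ s in (0 : ℝ)..t, F K s) atTop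
        (𝓝 (∫ s in (0 : ℝ)..t, (0 : ℝ))) := by
      refine intervalIntegral.tendsto_integral_filter_of_dominated_convergence (fun _ => 2) ?_ ?_
        intervalIntegrable_const ?_
      · refine Eventually.of_forall fun K => ?_
        refine ((hFc K).mono ?_).aestronglyMeasurable measurableSet_uIoc
        rw [Set.uIoc_of_le ht.1]
        exact Set.Ioc_subset_Icc_self
      · refine Eventually.of_forall fun K => Eventually.of_forall fun s _ => ?_
        have hb (i : Unit × ℕ) : (Profile.clip (x s)) i ≤ 1 :=
          (le_abs_self _).trans
              (((Profile.abs_apply_le (Profile.clip (x s))) i).trans (Profile.norm_clip_le (x s)))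
        have h0 (i : Unit × ℕ) : 0 ≤ (Profile.clip (x s)) i := (Profile.clip_nonneg (x s)) i
        have h1 := mul_nonneg (sub_nonneg.2 (hb ((), 0))) (h0 ((), K))
        have h2 := mul_le_mul (sub_le_self 1 (h0 ((), 0))) (hb ((), K)) (h0 _) zero_le_one
        simp only [F]
        rw [Real.norm_eq_abs, abs_le]
        constructor <;> linarith [hb ((), K + 1), h0 ((), K + 1)]
      · refine Eventually.of_forall fun s _ => ?_
        have h := (Profile.tendsto_apply (Profile.clip (x s))) ()
        have := ((tendsto_add_atTop_iff_nat 1).2 h).sub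
            (h.const_mul (1 - (Profile.clip (x s)) ((), 0)))
        simpa using this
    have hq1 : Tendsto (fun K => ∑ k ∈ Finset.range (K + 1), x 0 ((), k)) atTop (𝓝 1) := by
      simp only [hx0, toProfile_apply hq]
      exact (tendsto_add_atTop_iff_nat 1).2 hq.2.tendsto_sum_nat
    have := hlim.add hq1
    simp only [hint, sub_add_cancel, intervalIntegral.integral_zero, zero_add] at this
    exact this
  refine ⟨x, hx0, fun t ht => ?_, hprob⟩
  have h1 : ‖x t‖ ≤ 1 := by
    have h2 : x t = toProfile fun k => x t ((), k) := by
      ext ⟨_, k⟩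
      rw [toProfile_apply (hprob t ht)]
    rw [h2]
    exact (hprob t ht).norm_toProfile_le
  have h2 := hx t ht
  rwa [Profile.clip_eq_self (fun i => hnn i.2 t ht) h1] at h2

end

/-! ### Uniqueness, global existence and regularity of fluid solutions -/

section

lemma fluid_curve_unique {x y : ℝ → Profile Unit} {T : ℝ}
    (hx : ContinuousOn x (Set.Icc 0 T)) (hy : ContinuousOn y (Set.Icc 0 T))
    (hx' : ∀ t ∈ Set.Ico 0 T, HasDerivWithinAt x (fluidField (x t)) (Set.Ici t) t)
    (hy' : ∀ t ∈ Set.Ico 0 T, HasDerivWithinAt y (fluidField (y t)) (Set.Ici t) t)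
    (hxs : ∀ t ∈ Set.Ico 0 T, 0 ≤ x t ((), 0) ∧ ‖x t‖ ≤ 1)
    (hys : ∀ t ∈ Set.Ico 0 T, 0 ≤ y t ((), 0) ∧ ‖y t‖ ≤ 1)
    (h0 : x 0 = y 0) : Set.EqOn x y (Set.Icc 0 T) := by
  refine ODE_solution_unique_of_mem_Icc_right (v := fun _ => fluidField)
    (s := fun _ => {v | 0 ≤ v ((), 0) ∧ ‖v‖ ≤ 1}) (K := 6) (fun t _ => ?_) hx hx' hxs hy hy' hys h0
  refine LipschitzOnWith.of_dist_le_mul fun v hv w hw => ?_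
  rw [dist_eq_norm, dist_eq_norm]
  exact norm_fluidField_sub_le hv.1 hv.2 hw.2

lemma eq_toProfile {v : Profile Unit} (h : IsProb fun k => v ((), k)) :
    v = toProfile fun k => v ((), k) := by
  ext ⟨_, k⟩
  rw [toProfile_apply h]

lemma hasDerivWithinAt_Ici_of_Icc {E : Type*} [NormedAddCommGroup E] [NormedSpace ℝ E]
    {x : ℝ → E} {y : E} {T t : ℝ} (ht : t ∈ Set.Ico 0 T)
    (h : HasDerivWithinAt x y (Set.Icc 0 T) t) : HasDerivWithinAt x y (Set.Ici t) t :=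
  h.mono_of_mem_nhdsWithin
    (mem_of_superset (Icc_mem_nhdsGE ht.2) (Set.Icc_subset_Icc_left ht.1))

lemma exists_isFluidSolution {q : ℕ → ℝ} (hq : IsProb q) : ∃ 𝔮, IsFluidSolution q 𝔮 := by
  choose x hx0 hx hxp using fun N : ℕ => exists_fluid_curve hq (T := N) N.cast_nonneg
  have hb (N : ℕ) (t : ℝ) (ht : t ∈ Set.Ico (0 : ℝ) N) : 0 ≤ x N t ((), 0) ∧ ‖x N t‖ ≤ 1 := by
    have h := hxp N t ⟨ht.1, ht.2.le⟩
    refine ⟨h.1 0, ?_⟩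
    rw [eq_toProfile h]
    exact h.norm_toProfile_le
  have hle {M N : ℕ} (hMN : M ≤ N) : Set.EqOn (x M) (x N) (Set.Icc 0 M) := by
    have hMN' : (M : ℝ) ≤ N := by exact_mod_cast hMN
    refine fluid_curve_unique (fun t ht => (hx M t ht).continuousWithinAt)
      (fun t ht => ((hx N t ⟨ht.1, ht.2.trans hMN'⟩).continuousWithinAt).mono
        (Set.Icc_subset_Icc_right hMN'))
      (fun t ht => hasDerivWithinAt_Ici_of_Icc ht (hx M t ⟨ht.1, ht.2.le⟩))
      (fun t ht => hasDerivWithinAt_Ici_of_Icc ⟨ht.1, ht.2.trans_le hMN'⟩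
        (hx N t ⟨ht.1, ht.2.le.trans hMN'⟩))
      (hb M) (fun t ht => hb N t ⟨ht.1, ht.2.trans_le hMN'⟩) ?_
    rw [hx0, hx0]
  have hag {M N : ℕ} {t : ℝ} (h0 : 0 ≤ t) (hM : t ≤ M) (hN : t ≤ N) : x M t = x N t := by
    rcases le_total M N with h | h
    · exact hle h ⟨h0, hM⟩
    · exact (hle h ⟨h0, hN⟩).symm
  -- The solution at time t is read off the curve on [0, ⌈t⌉₊]; near t it coincides with the single
  -- curve on [0, N] for any N > t, hence inherits its derivative.
  have heq (N : ℕ) {t : ℝ} (h0 : 0 ≤ t) (hN : t ≤ N) (k : ℕ) :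
      x ⌈t⌉₊ t ((), k) = x N t ((), k) := by rw [hag h0 (Nat.le_ceil t) hN]
  refine ⟨fun t k => x ⌈t⌉₊ t ((), k), fun t ht => hxp _ t ⟨ht, Nat.le_ceil t⟩, ?_, ?_⟩
  · funext k
    rw [hx0, toProfile_apply hq]
  · intro k t ht
    obtain ⟨N, hN⟩ := exists_nat_gt t
    have hp := hxp N t ⟨ht, hN.le⟩
    have h1 := Profile.hasDerivWithinAt_apply (hx N t ⟨ht, hN.le⟩) ((), k)
    have h2 : fluidDrift (fun k => x ⌈t⌉₊ t ((), k)) k = fluidField (x N t) ((), k) := by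
      simp_rw [heq N ht hN.le]
      rw [hp.fluidDrift_eq, ← eq_toProfile hp]
    rw [h2]
    refine (h1.mono_of_mem_nhdsWithin ?_).congr_of_eventuallyEq ?_ (heq N ht hN.le k)
    · rw [← Set.Ici_inter_Iic]
      exact inter_mem self_mem_nhdsWithin (mem_nhdsWithin_of_mem_nhds (Iic_mem_nhds hN))
    · filter_upwards [self_mem_nhdsWithin, mem_nhdsWithin_of_mem_nhds (Iic_mem_nhds hN)]
        with s hs0 hsN using heq N hs0 hsN k

namespace IsFluidSolution

variable {q : ℕ → ℝ} {𝔮 : ℝ → ℕ → ℝ}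

lemma coord_bounds (h : IsFluidSolution q 𝔮) {t : ℝ} (ht : 0 ≤ t) :
    0 ≤ toProfile (𝔮 t) ((), 0) ∧ ‖toProfile (𝔮 t)‖ ≤ 1 := by
  rw [toProfile_apply (h.isProb t ht)]
  exact ⟨(h.isProb t ht).1 0, (h.isProb t ht).norm_toProfile_le⟩

lemma hasDerivWithinAt_coord (h : IsFluidSolution q 𝔮) {s t : ℝ} (hs : 0 ≤ s) (i : Unit × ℕ) :
    ∀ u ∈ Set.Icc s t, HasDerivWithinAt (fun u => toProfile (𝔮 u) i)
      (fluidField (toProfile (𝔮 u)) i) (Set.Icc s t) u := by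
  intro u hu
  have hsub : Set.Icc s t ⊆ Set.Ici 0 := fun r hr => hs.trans hr.1
  have h1 := (h.deriv i.2 u (hs.trans hu.1)).mono hsub
  rw [(h.isProb u (hs.trans hu.1)).fluidDrift_eq] at h1
  exact h1.congr (fun r hr => toProfile_apply (h.isProb r (hsub hr)) i)
    (toProfile_apply (h.isProb u (hsub hu)) i)

/-- A fluid solution is by definition only differentiable coordinate by coordinate; the uniform
bound 4 on the field upgrades this to a Lipschitz estimate in ℓ². -/
lemma norm_sub_le (h : IsFluidSolution q 𝔮) {s t : ℝ} (hs : 0 ≤ s) (hst : s ≤ t) :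
    ‖toProfile (𝔮 t) - toProfile (𝔮 s)‖ ≤ 4 * (t - s) :=
  Profile.norm_sub_le_of_hasDerivWithinAt (x := fun u => toProfile (𝔮 u))
    (y := fun u => fluidField (toProfile (𝔮 u))) hst (h.hasDerivWithinAt_coord hs)
    fun _ hu => norm_fluidField_le (h.coord_bounds (hs.trans hu.1)).1
      (h.coord_bounds (hs.trans hu.1)).2

lemma abs_sub_le (h : IsFluidSolution q 𝔮) {s t : ℝ} (hs : 0 ≤ s) (hst : s ≤ t) (k : ℕ) :
    |𝔮 t k - 𝔮 s k| ≤ 4 * (t - s) := by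
  have h1 := Profile.abs_apply_le (toProfile (𝔮 t) - toProfile (𝔮 s)) ((), k)
  rw [lp.coeFn_sub, Pi.sub_apply, toProfile_apply (h.isProb t (hs.trans hst)),
    toProfile_apply (h.isProb s hs)] at h1
  exact h1.trans (h.norm_sub_le hs hst)

/-- The field is 6-Lipschitz and the curve has speed at most 4, so the field moves by at most 24(t -
s). -/
lemma norm_sub_sub_le (h : IsFluidSolution q 𝔮) {s t : ℝ} (hs : 0 ≤ s) (hst : s ≤ t) :
    ‖toProfile (𝔮 t) - toProfile (𝔮 s) - (t - s) • fluidField (toProfile (𝔮 s))‖ ≤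
      24 * (t - s) ^ 2 := by
  have := Profile.norm_sub_le_of_hasDerivWithinAt (C := 24 * (t - s))
    (x := fun u => toProfile (𝔮 u) - (u - s) • fluidField (toProfile (𝔮 s)))
    (y := fun u => fluidField (toProfile (𝔮 u)) - fluidField (toProfile (𝔮 s))) hst ?_ ?_
  · simp only [sub_self, zero_smul, sub_zero] at this
    rw [sub_right_comm] at this
    linarith
  · intro i u hu
    refine (h.hasDerivWithinAt_coord hs i u hu).sub ?_
    have h1 : HasDerivWithinAt (fun u => (u - s) * fluidField (toProfile (𝔮 s)) i)
        (1 * fluidField (toProfile (𝔮 s)) i) (Set.Icc s t) u :=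
      ((hasDerivWithinAt_id u _).sub_const s).mul_const _
    rw [one_mul] at h1
    exact h1
  · intro u hu
    have hu0 := hs.trans hu.1
    have h1 := norm_fluidField_sub_le (h.coord_bounds hu0).1 (h.coord_bounds hu0).2
      (h.coord_bounds hs).2
    have h2 := h.norm_sub_le hs hu.1
    linarith [hu.2]

/-- Puts an arbitrary coordinatewise solution within reach of uniqueness for equations in ℓ². -/
lemma hasDerivWithinAt_profile (h : IsFluidSolution q 𝔮) {t : ℝ} (ht : 0 ≤ t) :
    HasDerivWithinAt (fun s => toProfile (𝔮 s)) (fluidField (toProfile (𝔮 t))) (Set.Ici t) t := by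
  rw [hasDerivWithinAt_iff_isLittleO]
  have h1 : (fun s => toProfile (𝔮 s) - toProfile (𝔮 t) - (s - t) • fluidField (toProfile (𝔮 t)))
      =O[𝓝[≥] t] fun s => (s - t) ^ 2 := by
    refine Asymptotics.IsBigO.of_bound 24 ?_
    filter_upwards [self_mem_nhdsWithin] with s hs
    rw [Real.norm_of_nonneg (sq_nonneg _)]
    exact h.norm_sub_sub_le ht hs
  refine h1.trans_isLittleO ?_
  have h2 : (fun s => (s - t) ^ 2) =o[𝓝 t] fun s => s - t := by
    have h3 : Tendsto (fun s : ℝ => s - t) (𝓝 t) (𝓝 0) := by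
      have h4 : Continuous fun s : ℝ => s - t := by fun_prop
      simpa using h4.tendsto t
    have := (Asymptotics.isLittleO_pow_id (𝕜 := ℝ) one_lt_two).comp_tendsto h3
    exact this
  exact h2.mono nhdsWithin_le_nhds

lemma unique {𝔮' : ℝ → ℕ → ℝ} (h : IsFluidSolution q 𝔮) (h' : IsFluidSolution q 𝔮') {t : ℝ}
    (ht : 0 ≤ t) : 𝔮' t = 𝔮 t := by
  have hc {r : ℝ → ℕ → ℝ} (h : IsFluidSolution q r) :
      ContinuousOn (fun s => toProfile (r s)) (Set.Icc 0 t) := by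
    refine LipschitzOnWith.continuousOn (K := 4)
        (LipschitzOnWith.of_dist_le_mul fun a ha b hb => ?_)
    rcases le_total a b with hab | hab
    · rw [dist_comm, dist_eq_norm, dist_comm, Real.dist_eq, abs_of_nonneg (sub_nonneg.2 hab)]
      exact h.norm_sub_le ha.1 hab
    · rw [dist_eq_norm, Real.dist_eq, abs_of_nonneg (sub_nonneg.2 hab)]
      exact h.norm_sub_le hb.1 hab
  have := fluid_curve_unique (hc h') (hc h) (fun s hs => h'.hasDerivWithinAt_profile hs.1)
    (fun s hs => h.hasDerivWithinAt_profile hs.1) (fun s hs => h'.coord_bounds hs.1)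
    (fun s hs => h.coord_bounds hs.1) (by rw [h.initial, h'.initial]) ⟨ht, le_rfl⟩
  funext k
  rw [← toProfile_apply (h'.isProb t ht) ((), k), ← toProfile_apply (h.isProb t ht) ((), k)]
  exact congrArg (fun v : Profile Unit => v ((), k)) this

end IsFluidSolution

end

section

/-! ### The generator acting on squared distances of empirical profiles -/

section Generator

variable {α : Type*} [DecidableEq α] {n m : ℕ}

/-- The empirical profile `(1/n) ∑_i δ_{(a_i, x_i)}`. -/
def occupation (a : Fin n → α) (x : Fin n → ℕ) : Profile α :=
  (1 / (n : ℝ)) • ∑ i, point (a i, x i)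

lemma norm_occupation_le (a : Fin n → α) (x : Fin n → ℕ) : ‖occupation a x‖ ≤ 1 := by
  have h1 : ‖∑ i, point (a i, x i)‖ ≤ n := by
    refine (norm_sum_le _ _).trans ?_
    simp [norm_point]
  rw [occupation, norm_smul, Real.norm_of_nonneg (by positivity), one_div]
  exact (mul_le_mul_of_nonneg_left h1 (by positivity)).trans
    (inv_mul_le_one_of_le₀ le_rfl (by positivity))

/-- The fraction of empty sites. -/
def emptyFraction (x : Fin n → ℕ) : ℝ := occupation (fun _ => ()) x ((), 0)

lemma occupation_apply (a : Fin n → α) (x : Fin n → ℕ) (y : α × ℕ) :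
    occupation a x y = (1 / (n : ℝ)) * ∑ i, if y = (a i, x i) then (1 : ℝ) else 0 := by
  rw [occupation, lp.coeFn_smul, Pi.smul_apply, lp.coeFn_sum, Finset.sum_apply, smul_eq_mul]
  simp_rw [point_apply]

lemma one_sub_emptyFraction (hn : 0 < n) (x : Fin n → ℕ) :
    1 - emptyFraction x = (1 / (n : ℝ)) * ∑ i, if 0 < x i then (1 : ℝ) else 0 := by
  have hn' : (n : ℝ) ≠ 0 := by positivity
  have h1 : (1 : ℝ) = (1 / (n : ℝ)) * ∑ _i : Fin n, 1 := by simp [hn']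
  rw [emptyFraction, occupation_apply]
  nth_rw 1 [h1]
  rw [← mul_sub, ← Finset.sum_sub_distrib]
  congr 1
  refine Finset.sum_congr rfl fun i _ => ?_
  rcases Nat.eq_zero_or_pos (x i) with h | h
  · simp [h]
  · simp [h, h.ne]

lemma abs_one_sub_emptyFraction_le (x : Fin n → ℕ) : |1 - emptyFraction x| ≤ 1 := by
  refine Profile.abs_one_sub_apply_le ?_ (norm_occupation_le _ _)
  rw [occupation_apply]
  refine mul_nonneg (by positivity) (Finset.sum_nonneg fun i _ => ?_)
  split_ifs <;> norm_num

/-- The first-order effect, up to the factor `1/n`, of a jump from `i` to `j`. -/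
def jumpProfile (a : Fin n → α) (x : Fin n → ℕ) (i j : Fin n) : Profile α :=
  death α (point (a i, x i)) + birth α (point (a j, x j))

lemma norm_jumpProfile_le (a : Fin n → α) (x : Fin n → ℕ) (i j : Fin n) :
    ‖jumpProfile a x i j‖ ≤ 4 := by
  have h1 := norm_death_le (point (a i, x i))
  have h2 := norm_birth_le (point (a j, x j))
  rw [norm_point] at h1 h2
  exact (norm_add_le _ _).trans (by linarith)

/-- Only sites i and j change. The case i = j is excluded since such a move is trivial while the
jump profile need not vanish. -/
lemma occupation_move_sub (a : Fin n → α) (η : Config n m) {i j : Fin n} (hij : i ≠ j)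
    (h : 0 < η.1 i) :
    occupation a (η.move i j h).1 - occupation a η.1 = (1 / (n : ℝ)) • jumpProfile a η.1 i j := by
  rw [occupation, occupation, ← smul_sub, ← Finset.sum_sub_distrib]
  congr 1
  have key (k : Fin n) : point (a k, (η.move i j h).1 k) - point (a k, η.1 k) =
      (if k = i then death α (point (a k, η.1 k)) else 0) +
      (if k = j then birth α (point (a k, η.1 k)) else 0) := by
    by_cases hki : k = i
    · subst hki
      have h1 : (η.move k j h).1 k = η.1 k - 1 := by
        simp [Config.move, Pi.single_eq_of_ne hij]
      rw [h1, if_pos rfl, if_neg hij, add_zero]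
      obtain ⟨l, hl⟩ : ∃ l, η.1 k = l + 1 := ⟨η.1 k - 1, by omega⟩
      rw [hl, death_point_succ, Nat.add_sub_cancel]
    · by_cases hkj : k = j
      · subst hkj
        have h1 : (η.move i k h).1 k = η.1 k + 1 := by
          simp [Config.move, Pi.single_eq_of_ne hki]
        rw [h1, if_neg hki, if_pos rfl, zero_add, birth_point]
      · have h1 : (η.move i j h).1 k = η.1 k := by
          simp [Config.move, Pi.single_eq_of_ne hki, Pi.single_eq_of_ne hkj]
        rw [h1, if_neg hki, if_neg hkj, sub_self, add_zero]
  simp_rw [key]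
  rw [Finset.sum_add_distrib, Finset.sum_ite_eq' , Finset.sum_ite_eq']
  simp [jumpProfile]

lemma move_self (η : Config n m) (i : Fin n) (h : 0 < η.1 i) : η.move i i h = η :=
  Subtype.ext (funext fun k => by simp [Config.move])

/-- Expand ‖D + U/n‖² with ‖U‖ ≤ 4. For a self-jump the left side is zero, and the diagonal term
16/n compensates for a linear term that may be as low as -16/n. -/
lemma norm_sq_move_sub_le (hn : 0 < n) (a : Fin n → α) {v : Profile α} (hv : ‖v‖ ≤ 1)
    (η : Config n m) (i j : Fin n) (h : 0 < η.1 i) :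
    ‖occupation a (η.move i j h).1 - v‖ ^ 2 - ‖occupation a η.1 - v‖ ^ 2 ≤
      (2 / n) * inner ℝ (occupation a η.1 - v) (jumpProfile a η.1 i j) + 16 / (n : ℝ) ^ 2 +
        if i = j then 16 / (n : ℝ) else 0 := by
  have hn' : (0 : ℝ) < n := by positivity
  have hU := norm_jumpProfile_le a η.1 i j
  set D := occupation a η.1 - v
  set U := jumpProfile a η.1 i j
  by_cases hij : i = j
  · subst hij
    rw [move_self, if_pos rfl, sub_self]
    have hD : ‖D‖ ≤ 2 := (norm_sub_le _ _).trans (by linarith [norm_occupation_le a η.1])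
    have h1 : |inner ℝ D U| ≤ 2 * 4 :=
      (abs_real_inner_le_norm D U).trans (mul_le_mul hD hU (norm_nonneg _) zero_le_two)
    have h2 : (2 / (n : ℝ)) * (-8) ≤ (2 / n) * inner ℝ D U := by
      gcongr
      linarith [(abs_le.1 h1).1]
    have h3 : 16 / (n : ℝ) = -((2 / (n : ℝ)) * (-8)) := by ring
    have h4 : 0 ≤ 16 / (n : ℝ) ^ 2 := by positivity
    linarith
  · have h1 : occupation a (η.move i j h).1 - v = D + (1 / (n : ℝ)) • U := by
      rw [← occupation_move_sub a η hij h]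
      simp only [D]
      abel
    rw [h1, if_neg hij, add_zero, norm_add_sq_real, inner_smul_right, norm_smul,
      Real.norm_of_nonneg (by positivity)]
    have h2 : (1 / (n : ℝ) * ‖U‖) ^ 2 ≤ (1 / (n : ℝ) * 4) ^ 2 := by gcongr
    have h3 : (1 / (n : ℝ) * 4) ^ 2 = 16 / (n : ℝ) ^ 2 := by ring
    have h4 : 2 * (1 / (n : ℝ) * inner ℝ D U) = 2 / n * inner ℝ D U := by ring
    linarith

/-- Death annihilates empty sites, so the indicator is superfluous there; for births it counts the
nonempty origins i and produces the rate 1 - `emptyFraction x`. -/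
lemma sum_jumpProfile (hn : 0 < n) (a : Fin n → α) (x : Fin n → ℕ) :
    (1 / (n : ℝ) ^ 2) • ∑ i, ∑ j, (if 0 < x i then jumpProfile a x i j else 0) =
      drift (1 - emptyFraction x) (occupation a x) := by
  have hn' : (n : ℝ) ≠ 0 := by positivity
  have h1 (i : Fin n) : ∑ j, (if 0 < x i then jumpProfile a x i j else 0) =
      (n : ℝ) • death α (point (a i, x i)) +
        (if 0 < x i then (1 : ℝ) else 0) • ∑ j, birth α (point (a j, x j)) := by
    rcases Nat.eq_zero_or_pos (x i) with h | h
    · simp [h, death_point_zero]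
    · simp [h, jumpProfile, Finset.sum_add_distrib, Nat.cast_smul_eq_nsmul]
  simp_rw [h1]
  rw [Finset.sum_add_distrib, ← Finset.smul_sum, ← Finset.sum_smul, one_sub_emptyFraction hn,
    drift, occupation]
  simp only [map_smul, map_sum, smul_add, smul_smul]
  congr 2
  · field_simp
  · field_simp

/-- Of the error 32/n, half comes from n² pairs with 16/n² each and half from n diagonal pairs with
16/n each, all multiplied by 1/n. -/
lemma generator_norm_sq_le (hn : 0 < n) (a : Fin n → α) {v : Profile α} (hv : ‖v‖ ≤ 1)
    (η : Config n m) :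
    generator n m (fun η => ‖occupation a η.1 - v‖ ^ 2) η ≤
      2 * inner ℝ (occupation a η.1 - v)
        (drift (1 - emptyFraction η.1) (occupation a η.1)) + 32 / n := by
  have hn' : (0 : ℝ) < n := by positivity
  have hgen : generator n m (fun η => ‖occupation a η.1 - v‖ ^ 2) η = (1 / (n : ℝ)) *
      ∑ i : Fin n, ∑ j : Fin n, if h : 0 < η.1 i then
        (‖occupation a (η.move i j h).1 - v‖ ^ 2 - ‖occupation a η.1 - v‖ ^ 2) else 0 := rfl
  rw [hgen, ← sum_jumpProfile hn]
  set D := occupation a η.1 - v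
  have hterm : ∀ i j : Fin n, (if h : 0 < η.1 i then
      (‖occupation a (η.move i j h).1 - v‖ ^ 2 - ‖D‖ ^ 2) else 0) ≤
      (2 / n) * inner ℝ D (if 0 < η.1 i then jumpProfile a η.1 i j else 0) +
        16 / (n : ℝ) ^ 2 + if i = j then 16 / (n : ℝ) else 0 := by
    intro i j
    by_cases h : 0 < η.1 i
    · rw [dif_pos h, if_pos h]
      exact norm_sq_move_sub_le hn a hv η i j h
    · rw [dif_neg h, if_neg h, inner_zero_right]
      have : 0 ≤ if i = j then 16 / (n : ℝ) else 0 := by split_ifs <;> positivity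
      positivity
  have hsum := Finset.sum_le_sum fun i (_ : i ∈ (Finset.univ : Finset (Fin n))) =>
    Finset.sum_le_sum fun j (_ : j ∈ (Finset.univ : Finset (Fin n))) => hterm i j
  refine (mul_le_mul_of_nonneg_left hsum (by positivity : 0 ≤ 1 / (n : ℝ))).trans_eq ?_
  simp only [Finset.sum_add_distrib, ← Finset.mul_sum, ← inner_sum, Finset.sum_ite_eq,
    Finset.mem_univ, if_true, Finset.sum_const, Finset.card_univ, Fintype.card_fin, nsmul_eq_mul,
    inner_smul_right]
  field_simp
  ring

/-- One step of the dynamics hardly increases the squared distance to an approximate solution. -/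
lemma norm_sq_add_generator_le (hn : 0 < n) (a : Fin n → α) (η : Config n m) {v v' : Profile α}
    (hv : ‖v‖ ≤ 1) (hv' : ‖v'‖ ≤ 1) {c h C : ℝ} (hc : |c| ≤ 1) (h0 : 0 ≤ h) (h1 : h ≤ 1)
    (hC : 0 ≤ C) (hvv : ‖v' - v - h • drift c v‖ ≤ C * h ^ 2) :
    ‖occupation a η.1 - v'‖ ^ 2 + h * generator n m (fun η => ‖occupation a η.1 - v'‖ ^ 2) η ≤
      ‖occupation a η.1 - v‖ ^ 2 +
        h * (10 * ‖occupation a η.1 - v‖ ^ 2 + 2 * (1 - emptyFraction η.1 - c) ^ 2) +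
        32 / n * h + (C ^ 2 + 20 * C + 48) * h ^ 2 := by
  have hgen := generator_norm_sq_le hn a hv' η
  have hV := norm_occupation_le a η.1
  have hΛ := abs_one_sub_emptyFraction_le η.1
  set V := occupation a η.1
  set Λ := 1 - emptyFraction η.1
  set r := v' - v - h • drift c v with hr
  set g := drift c v with hg
  set G := drift Λ V with hG
  set D := V - v with hD
  have hgn : ‖g‖ ≤ 4 := (norm_drift_le hc v).trans (by linarith)
  have hGn : ‖G‖ ≤ 4 := (norm_drift_le hΛ V).trans (by linarith)
  have hDn : ‖D‖ ≤ 2 := (norm_sub_le _ _).trans (by linarith)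
  have hD' : V - v' = D - (h • g + r) := by
    rw [hD, hr]
    abel
  set e := h • g + r with he
  have hh2 : h ^ 2 ≤ h := by nlinarith
  have hen : ‖e‖ ≤ (4 + C) * h := by
    have h2 := norm_add_le (h • g) r
    rw [norm_smul, Real.norm_of_nonneg h0] at h2
    have h3 : h * ‖g‖ ≤ h * 4 := by gcongr
    have h4 : C * h ^ 2 ≤ C * h := by gcongr
    linarith
  have hesq : ‖e‖ ^ 2 ≤ (4 + C) ^ 2 * h ^ 2 := by
    rw [← mul_pow]
    gcongr
  -- The moving target contributes -2h⟨D, g⟩ and the generator 2h⟨D, G⟩; only the difference of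
  -- drifts survives to first order.
  have hsq : ‖V - v'‖ ^ 2 = ‖D‖ ^ 2 - 2 * (h * inner ℝ D g + inner ℝ D r) + ‖e‖ ^ 2 := by
    rw [hD', norm_sub_sq_real, he, inner_add_right, inner_smul_right]
  have hin : inner ℝ (V - v') G = inner ℝ D G - inner ℝ e G := by
    rw [hD', inner_sub_left]
  have hDr : -(2 * (C * h ^ 2)) ≤ inner ℝ D r := by
    have h2 := abs_real_inner_le_norm D r
    have h3 : ‖D‖ * ‖r‖ ≤ 2 * (C * h ^ 2) := mul_le_mul hDn hvv (norm_nonneg _) zero_le_two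
    linarith [(abs_le.1 h2).1]
  have heG : -((4 + C) * h * 4) ≤ inner ℝ e G := by
    have h2 := abs_real_inner_le_norm e G
    have h3 : ‖e‖ * ‖G‖ ≤ (4 + C) * h * 4 := mul_le_mul hen hGn (norm_nonneg _) (by positivity)
    linarith [(abs_le.1 h2).1]
  -- 4‖D‖² is the norm bound for `drift Λ`; the fifth comes from 2|Λ - c|‖D‖ ≤ ‖D‖² + (Λ - c)².
  have hDG : inner ℝ D G - inner ℝ D g ≤ 5 * ‖D‖ ^ 2 + (Λ - c) ^ 2 := by
    have h2 : G - g = drift Λ D + (Λ - c) • birth α v := drift_sub_drift Λ c V v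
    rw [← inner_sub_right, h2, inner_add_right, inner_smul_right]
    have h3 : inner ℝ D (drift Λ D) ≤ ‖D‖ * (4 * ‖D‖) :=
      (real_inner_le_norm _ _).trans (by gcongr; exact norm_drift_le hΛ D)
    have h4 : |inner ℝ D (birth α v)| ≤ ‖D‖ * 2 :=
      (abs_real_inner_le_norm _ _).trans (by
        gcongr
        exact (norm_birth_le v).trans (by linarith))
    have h5 : (Λ - c) * inner ℝ D (birth α v) ≤ |Λ - c| * (‖D‖ * 2) := by
      refine (le_abs_self _).trans ?_
      rw [abs_mul]
      gcongr
    nlinarith [sq_nonneg (|Λ - c| - ‖D‖), sq_abs (Λ - c)]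
  have hmul := mul_le_mul_of_nonneg_left hgen h0
  rw [hin] at hmul
  have hmul2 := mul_le_mul_of_nonneg_left hDG (by positivity : 0 ≤ 2 * h)
  have hmul3 := mul_le_mul_of_nonneg_left heG (by positivity : 0 ≤ 2 * h)
  rw [hsq]
  have e1 : h * (32 / (n : ℝ)) = 32 / n * h := by ring
  linarith

end Generator

end

section

/-! ### A maximal inequality along the process -/

/-- Differentiability of the exponential in operator norm makes `h₀` independent of f, which matters
because the test function changes from one time step to the next. -/
lemma semigroup_le (n m : ℕ) {δ : ℝ} (hδ : 0 < δ) :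
    ∃ h₀ > 0, ∀ h : ℝ≥0, (h : ℝ) ≤ h₀ → ∀ (f : Config n m → ℝ) (M : ℝ), (∀ η, |f η| ≤ M) → ∀ η,
      semigroup n m h f η ≤ f η + h * generator n m f η + δ * M * h := by
  have h1 : HasDerivAt (fun t : ℝ => NormedSpace.exp (t • generator n m)) (generator n m) 0 := by
    have := hasDerivAt_exp_smul_const (𝕂 := ℝ) (generator n m) (0 : ℝ)
    simpa using this
  rw [hasDerivAt_iff_isLittleO, Asymptotics.isLittleO_iff] at h1
  obtain ⟨h₀, h₀pos, hh⟩ := Metric.eventually_nhds_iff.1 (h1 hδ)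
  refine ⟨h₀ / 2, by positivity, fun h hle f M hM η => ?_⟩
  have h2 := hh (y := (h : ℝ)) (by
    rw [Real.dist_eq, sub_zero, abs_of_nonneg h.coe_nonneg]
    linarith)
  simp only [zero_smul, NormedSpace.exp_zero, sub_zero, Real.norm_of_nonneg h.coe_nonneg] at h2
  have hM0 : 0 ≤ M := (abs_nonneg _).trans (hM η)
  have hf : ‖f‖ ≤ M := (pi_norm_le_iff_of_nonneg hM0).2 hM
  set R := NormedSpace.exp ((h : ℝ) • generator n m) - 1 - (h : ℝ) • generator n m
  have h3 : ‖R f‖ ≤ δ * h * M :=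
    (R.le_of_opNorm_le h2 f).trans (mul_le_mul_of_nonneg_left hf (by positivity))
  have h4 : R f η ≤ δ * h * M :=
    (le_abs_self _).trans ((norm_le_pi_norm (R f) η).trans h3)
  have h5 : R f η = semigroup n m h f η - f η - h * generator n m f η := rfl
  linarith

/-- Take the first grid point at or after t, once the mesh is below u - t. Right-continuous paths
are thus determined by dyadic grids containing the endpoint T. -/
lemma eventually_exists_grid {t T u : ℝ≥0} (htT : t ≤ T) (htu : t < u) :
    ∀ᶠ K : ℕ in atTop, ∃ i : ℕ, i ≤ 2 ^ K ∧ t ≤ i * (T / 2 ^ K) ∧ i * (T / 2 ^ K) < u := by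
  rcases eq_or_ne T 0 with h0 | h0
  · have ht : t = 0 := le_antisymm (htT.trans_eq h0) zero_le
    subst ht
    exact Eventually.of_forall fun K => ⟨0, by simp, by simp, by simpa using htu⟩
  · have hT : 0 < T := pos_iff_ne_zero.2 h0
    have hlim : Tendsto (fun K : ℕ => T / 2 ^ K) atTop (𝓝 0) := by
      have h1 : Tendsto (fun K : ℕ => (1 / 2 : ℝ≥0) ^ K) atTop (𝓝 0) :=
        NNReal.tendsto_pow_atTop_nhds_zero_of_lt_one (by
          rw [div_lt_one (by norm_num)]
          norm_num)
      have h2 := h1.const_mul T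
      simpa [div_eq_mul_inv] using h2
    filter_upwards [hlim.eventually_lt_const (tsub_pos_of_lt htu)] with K hK
    have hh : 0 < T / 2 ^ K := by positivity
    refine ⟨⌈t / (T / 2 ^ K)⌉₊, ?_, ?_, ?_⟩
    · rw [Nat.ceil_le, div_le_iff₀ hh]
      push_cast
      rw [mul_div_cancel₀ _ (by positivity)]
      exact htT
    · rw [← div_le_iff₀ hh]
      exact Nat.le_ceil _
    · calc (⌈t / (T / 2 ^ K)⌉₊ : ℝ≥0) * (T / 2 ^ K)
          ≤ (t / (T / 2 ^ K) + 1) * (T / 2 ^ K) := by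
            gcongr
            exact (Nat.ceil_lt_add_one zero_le).le
        _ = t + T / 2 ^ K := by
            rw [add_mul, one_mul, div_mul_cancel₀ _ hh.ne']
        _ < u := by
            rw [add_comm]
            exact lt_tsub_iff_right.1 hK

namespace IsZeroRangeProcess

variable {Ω : Type*} [MeasurableSpace Ω] {P : Measure Ω} {n m : ℕ}
  {η : ℝ≥0 → Ω → Config n m} {η₀ : Config n m}

lemma measurable_comp (h : IsZeroRangeProcess P η η₀) (f : Config n m → ℝ) (t : ℝ≥0) :
    Measurable fun ω => f (η t ω) :=
  (measurable_from_top (f := f)).comp (h.measurable t)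

lemma integrable_comp [IsProbabilityMeasure P] (h : IsZeroRangeProcess P η η₀)
    (f : Config n m → ℝ) (t : ℝ≥0) :
    Integrable (fun ω => f (η t ω)) P :=
  Integrable.of_bound (h.measurable_comp f t).aestronglyMeasurable ‖f‖
    (Eventually.of_forall fun ω => norm_le_pi_norm f (η t ω))

lemma past_le (h : IsZeroRangeProcess P η η₀) (s : ℝ≥0) :
    (⨆ u : Set.Iic s, MeasurableSpace.comap (η u) inferInstance) ≤
      (inferInstance : MeasurableSpace Ω) :=
  iSup_le fun u => (h.measurable u).comap_le

omit [MeasurableSpace Ω] in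
lemma measurableSet_past {s u : ℝ≥0} (hu : u ≤ s) (A : Set (Config n m)) :
    MeasurableSet[⨆ u : Set.Iic s, MeasurableSpace.comap (η u) inferInstance] (η u ⁻¹' A) :=
  le_iSup (fun u : Set.Iic s => MeasurableSpace.comap (η u) inferInstance) ⟨u, hu⟩ _
    ⟨A, trivial, rfl⟩

/-- The form in which the Markov property enters the maximal inequality: integrated over an event of
the past. -/
lemma setIntegral_eq [IsProbabilityMeasure P] (h : IsZeroRangeProcess P η η₀) {s t : ℝ≥0}
    (hst : s ≤ t)
    (f : Config n m → ℝ) {B : Set Ω}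
    (hB : MeasurableSet[⨆ u : Set.Iic s, MeasurableSpace.comap (η u) inferInstance] B) :
    ∫ ω in B, f (η t ω) ∂P = ∫ ω in B, semigroup n m (t - s) f (η s ω) ∂P := by
  rw [← setIntegral_condExp (h.past_le s) (h.integrable_comp f t) hB]
  exact setIntegral_congr_ae (h.past_le s _ hB) ((h.markov s t hst f).mono fun ω hω _ => hω)

/-- A maximal inequality for nonnegative approximate supermartingales along a regular grid. -/
lemma maximal_grid [IsProbabilityMeasure P] (hη : IsZeroRangeProcess P η η₀) {a c e : ℝ}
    (ha : 0 ≤ a) (hc : 0 ≤ c)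
    (he : 0 ≤ e) {h : ℝ≥0} {N : ℕ} {f : ℕ → Config n m → ℝ} (hf : ∀ i x, 0 ≤ f i x)
    (hstep : ∀ i x, semigroup n m h (f (i + 1)) x ≤ (1 + c) * f i x + e) :
    a * P.real {ω | ∃ i ≤ N, a < f i (η (i * h) ω)} ≤ (1 + c) ^ N * (f 0 η₀ + N * e) := by
  -- `B k` is the event that level a has not been exceeded up to step k; it belongs to the past at
  -- that step.
  set B : ℕ → Set Ω := fun k => {ω | ∀ i ≤ k, f i (η (i * h) ω) ≤ a} with hBdef
  have hBm' (k : ℕ) : MeasurableSet[⨆ u : Set.Iic ((k : ℝ≥0) * h),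
      MeasurableSpace.comap (η u) inferInstance] (B k) := by
    have : B k = ⋂ i ∈ Finset.range (k + 1), η (i * h) ⁻¹' {x | f i x ≤ a} := by
      ext ω
      simp [hBdef]
    rw [this]
    refine Finset.measurableSet_biInter _ fun i hi => measurableSet_past ?_ _
    have : (i : ℝ≥0) ≤ k := by exact_mod_cast Nat.lt_succ_iff.1 (Finset.mem_range.1 hi)
    gcongr
  have hBm (k : ℕ) : MeasurableSet (B k) := hη.past_le _ _ (hBm' k)
  have hBc (k : ℕ) : P.real {ω | ∃ i ≤ k, a < f i (η (i * h) ω)} = P.real (B k)ᶜ := by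
    congr 1
    ext ω
    simp [hBdef]
  have hsub (k : ℕ) : B (k + 1) ⊆ B k := fun ω hω i hi => hω i (hi.trans k.le_succ)
  have hint (k : ℕ) := hη.integrable_comp (f k) (k * h)
  have hsplit (g : Ω → ℝ) (hg : Integrable g P) (k : ℕ) : ∫ ω in B k, g ω ∂P =
      ∫ ω in B (k + 1), g ω ∂P + ∫ ω in B k \ B (k + 1), g ω ∂P := by
    rw [← setIntegral_union Set.disjoint_sdiff_right ((hBm k).diff (hBm (k + 1)))
      hg.integrableOn hg.integrableOn, Set.union_sdiff_cancel (hsub k)]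
  have hPc (k : ℕ) : P.real (B (k + 1))ᶜ = P.real (B k)ᶜ + P.real (B k \ B (k + 1)) := by
    rw [← measureReal_union ?_ ((hBm k).diff (hBm (k + 1)))]
    · congr 1
      ext ω
      have := @hsub k ω
      simp only [Set.mem_compl_iff, Set.mem_union, Set.mem_sdiff]
      tauto
    · exact Set.disjoint_left.2 fun ω h1 h2 => h1 h2.1
  have hexit (k : ℕ) : a * P.real (B k \ B (k + 1)) ≤
      ∫ ω in B k \ B (k + 1), f (k + 1) (η ((k + 1 : ℕ) * h) ω) ∂P := by
    rw [mul_comm, ← smul_eq_mul, ← setIntegral_const]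
    refine setIntegral_mono_on (integrable_const _).integrableOn (hint (k + 1)).integrableOn
      ((hBm k).diff (hBm (k + 1))) fun ω hω => ?_
    by_contra! hlt
    refine hω.2 fun i hi => ?_
    rcases Nat.le_succ_iff.1 hi with h1 | h1
    · exact hω.1 i h1
    · subst h1
      exact hlt.le
  have hcond (k : ℕ) : ∫ ω in B k, f (k + 1) (η ((k + 1 : ℕ) * h) ω) ∂P ≤
      (1 + c) * ∫ ω in B k, f k (η (k * h) ω) ∂P + e := by
    have hle : (k : ℝ≥0) * h ≤ (k + 1 : ℕ) * h := by
      gcongr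
      exact k.le_succ
    have hsubh : ((k + 1 : ℕ) : ℝ≥0) * h - k * h = h := by
      push_cast
      rw [add_mul, one_mul, add_tsub_cancel_left]
    rw [hη.setIntegral_eq hle (f (k + 1)) (hBm' k), hsubh]
    have h1 : ∫ ω in B k, semigroup n m h (f (k + 1)) (η (k * h) ω) ∂P ≤
        ∫ ω in B k, ((1 + c) * f k (η (k * h) ω) + e) ∂P :=
      setIntegral_mono (hη.integrable_comp _ _).integrableOn
        (((hint k).const_mul _).add (integrable_const _)).integrableOn fun ω => hstep k _
    refine h1.trans ?_
    rw [integral_add ((hint k).const_mul _).integrableOn (integrable_const _).integrableOn,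
      integral_const_mul, setIntegral_const, smul_eq_mul]
    gcongr
    exact mul_le_of_le_one_left he measureReal_le_one
  -- The left side is a lower bound for the expectation of the process stopped on exceeding a: mass
  -- leaving `B k` is counted with value a, the rest evolves by `hcond`.
  have main (k : ℕ) : a * P.real (B k)ᶜ + ∫ ω in B k, f k (η (k * h) ω) ∂P ≤
      (1 + c) ^ k * (f 0 η₀ + k * e) := by
    induction k with
    | zero =>
      have h0 : ∀ᵐ ω ∂P, f 0 (η ((0 : ℕ) * h) ω) = f 0 η₀ := by
        filter_upwards [hη.initial] with ω hω
        rw [Nat.cast_zero, zero_mul, hω]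
      have h1 : ∫ ω in B 0, f 0 (η ((0 : ℕ) * h) ω) ∂P = P.real (B 0) * f 0 η₀ := by
        rw [setIntegral_congr_ae (g := fun _ => f 0 η₀) (hBm 0) (h0.mono fun ω hω _ => hω),
          setIntegral_const, smul_eq_mul]
      -- The start is only almost surely `η₀`, so either this event is null or f 0 η₀ > a.
      have h2 : a * P.real (B 0)ᶜ ≤ f 0 η₀ * P.real (B 0)ᶜ := by
        rcases eq_or_ne (P.real (B 0)ᶜ) 0 with h3 | h3
        · rw [h3, mul_zero, mul_zero]
        · have h4 : ∃ ω ∈ (B 0)ᶜ, f 0 (η ((0 : ℕ) * h) ω) = f 0 η₀ := by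
            by_contra! hne
            refine h3 ?_
            rw [measureReal_eq_zero_iff]
            exact measure_mono_null (fun ω hω => hne ω hω) h0
          obtain ⟨ω, hω, hω0⟩ := h4
          refine mul_le_mul_of_nonneg_right ?_ measureReal_nonneg
          simp only [hBdef, Set.mem_compl_iff, Set.mem_ofPred_eq, Nat.le_zero, forall_eq,
            not_le] at hω
          exact (hω.trans_eq hω0).le
      rw [h1, pow_zero, one_mul, Nat.cast_zero, zero_mul, add_zero]
      have h3 : P.real (B 0) + P.real (B 0)ᶜ = 1 := probReal_add_probReal_compl (hBm 0)
      have h4 : f 0 η₀ * P.real (B 0) + f 0 η₀ * P.real (B 0)ᶜ = f 0 η₀ := by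
        rw [← mul_add, h3, mul_one]
      linarith
    | succ k ih =>
      have h1 := hsplit _ (hint (k + 1)) k
      have h2 := hexit k
      have h3 := hcond k
      have h4 : a * P.real (B k)ᶜ ≤ (1 + c) * (a * P.real (B k)ᶜ) :=
        le_mul_of_one_le_left (mul_nonneg ha measureReal_nonneg) (by linarith)
      have h5 := mul_le_mul_of_nonneg_left ih (by linarith : 0 ≤ 1 + c)
      have h6 : e ≤ (1 + c) ^ (k + 1) * e :=
        le_mul_of_one_le_left he (one_le_pow₀ (by linarith))
      rw [hPc]
      push_cast at h2 h3 h1 ⊢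
      have h7 : (1 + c) ^ (k + 1) * (f 0 η₀ + (k + 1) * e) =
        (1 + c) * ((1 + c) ^ k * (f 0 η₀ + k * e)) + (1 + c) ^ (k + 1) * e := by ring
      rw [h7]
      linarith
  rw [hBc]
  have := setIntegral_nonneg (μ := P) (hBm N) fun ω _ => hf N (η (N * h) ω)
  linarith [main N]

/-- A maximal inequality for nonnegative functions decreasing up to an error along the flow. -/
lemma maximal [IsProbabilityMeasure P] (hη : IsZeroRangeProcess P η η₀) {a c e C M : ℝ}
    (ha : 0 ≤ a) (hc : 0 ≤ c)
    (he : 0 ≤ e) (hC : 0 ≤ C) {f : ℝ≥0 → Config n m → ℝ} (hf : ∀ t x, 0 ≤ f t x)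
    (hfM : ∀ t x, f t x ≤ M) (hfc : ∀ x, Continuous fun t => f t x)
    (hstep : ∀ (t h : ℝ≥0) x, h ≤ 1 → f (t + h) x + h * generator n m (f (t + h)) x ≤
      (1 + c * h) * f t x + e * h + C * (h : ℝ) ^ 2) (T : ℝ≥0) :
    a * P.real {ω | ∃ t ≤ T, a < f t (η t ω)} ≤ Real.exp (c * T) * (f 0 η₀ + e * T) := by
  have hM : 0 ≤ M := (hf 0 η₀).trans (hfM 0 η₀)
  set A : ℕ → Set Ω := fun K =>
    {ω | ∃ i : ℕ, i ≤ 2 ^ K ∧ a < f (i * (T / 2 ^ K)) (η (i * (T / 2 ^ K)) ω)} with hA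
  have hAmono : Monotone A := by
    refine monotone_nat_of_le_succ fun K ω => ?_
    rintro ⟨i, hi, hω⟩
    have h1 : ((2 * i : ℕ) : ℝ≥0) * (T / 2 ^ (K + 1)) = i * (T / 2 ^ K) := by
      push_cast
      rw [pow_succ]
      field_simp
    refine ⟨2 * i, ?_, ?_⟩
    · rw [pow_succ]
      omega
    · rwa [h1]
  -- An excess over a persists on some [t, u), by right continuity of the path and continuity of f
  -- in time, hence shows on a fine grid.
  have hsub : {ω | ∃ t ≤ T, a < f t (η t ω)} ⊆ ⋃ K, A K := by
    rintro ω ⟨t, htT, hω⟩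
    rw [Set.mem_iUnion]
    have hev : ∀ᶠ s in 𝓝[≥] t, a < f s (η s ω) := by
      filter_upwards [hη.right_continuous ω t,
        ((hfc (η t ω)).continuousWithinAt (s := Set.Ici t) (x := t)).eventually_const_lt hω]
        with s h1 h2
      rwa [h1]
    obtain ⟨u, hu, hsubu⟩ := mem_nhdsGE_iff_exists_Ico_subset.1 hev
    obtain ⟨K, i, hi, h1, h2⟩ := (eventually_exists_grid htT hu).exists
    exact ⟨K, i, hi, hsubu ⟨h1, h2⟩⟩
  -- δ absorbs both the semigroup remainder δMh and, once the mesh h is below δ, the error Ch² ≤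
  -- Cδh; it is sent to zero at the end.
  have hbound (δ : ℝ) (hδ : 0 < δ) :
      a * P.real {ω | ∃ t ≤ T, a < f t (η t ω)} ≤
        Real.exp (c * T) * (f 0 η₀ + T * (e + δ * (C + M))) := by
    obtain ⟨h₀, h₀pos, hsg⟩ := semigroup_le n m hδ
    have hlim : Tendsto (fun K : ℕ => (T : ℝ) / 2 ^ K) atTop (𝓝 0) := by
      have h1 : Tendsto (fun K : ℕ => (1 / 2 : ℝ) ^ K) atTop (𝓝 0) :=
        tendsto_pow_atTop_nhds_zero_of_lt_one (by norm_num) (by norm_num)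
      have h2 := h1.const_mul (T : ℝ)
      simpa [div_eq_mul_inv] using h2
    have hAK : ∀ᶠ K in atTop, a * P.real (A K) ≤
        Real.exp (c * T) * (f 0 η₀ + T * (e + δ * (C + M))) := by
      filter_upwards [hlim.eventually_lt_const h₀pos, hlim.eventually_lt_const hδ,
        hlim.eventually_lt_const one_pos] with K h1 h2 h3
      set h : ℝ≥0 := T / 2 ^ K with hh
      have hcoe : (h : ℝ) = (T : ℝ) / 2 ^ K := by
        rw [hh]
        push_cast
        rfl
      rw [← hcoe] at h1 h2 h3
      have hgrid := hη.maximal_grid (a := a) (c := c * h) (e := (e + δ * (C + M)) * h) ha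
        (by positivity) (by positivity) (h := h) (N := 2 ^ K) (f := fun i => f (i * h))
        (fun i x => hf _ x) (fun i x => by
          have e1 := hsg h h1.le (f ((i + 1 : ℕ) * h)) M
            (fun y => by rw [abs_of_nonneg (hf _ y)]; exact hfM _ y) x
          have e2 := hstep (i * h) h x (by exact_mod_cast h3.le)
          have e3 : (i : ℝ≥0) * h + h = (i + 1 : ℕ) * h := by
            push_cast
            ring
          rw [e3] at e2
          have e4 : C * (h : ℝ) ^ 2 ≤ C * δ * h := by
            rw [pow_two, ← mul_assoc]
            gcongr
          refine e1.trans ?_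
          have e5 : (e + δ * (C + M)) * (h : ℝ) = e * h + C * δ * h + δ * M * h := by ring
          rw [e5]
          linarith)
      refine hgrid.trans ?_
      have hN : ((2 ^ K : ℕ) : ℝ) * h = T := by
        rw [hcoe]
        push_cast
        field_simp
      have hexp : (1 + c * h) ^ (2 ^ K) ≤ Real.exp (c * T) := by
        have e1 : 1 + c * h ≤ Real.exp (c * h) := by linarith [Real.add_one_le_exp (c * h)]
        refine (pow_le_pow_left₀ (by positivity) e1 _).trans_eq ?_
        rw [← Real.exp_nat_mul, mul_left_comm, hN]
      have hT' : ((2 ^ K : ℕ) : ℝ) * ((e + δ * (C + M)) * h) = T * (e + δ * (C + M)) := by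
        rw [mul_left_comm, hN, mul_comm]
      rw [hT']
      simp only [Nat.cast_zero, zero_mul]
      have : 0 ≤ f 0 η₀ := hf 0 η₀
      gcongr
    have hU : a * P.real (⋃ K, A K) ≤ Real.exp (c * T) * (f 0 η₀ + T * (e + δ * (C + M))) := by
      have h1 := tendsto_measure_iUnion_atTop (μ := P) hAmono
      have h2 : Tendsto (fun K => P.real (A K)) atTop (𝓝 (P.real (⋃ K, A K))) :=
        (ENNReal.tendsto_toReal (measure_ne_top _ _)).comp h1
      exact le_of_tendsto (h2.const_mul a) hAK
    refine le_trans ?_ hU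
    exact mul_le_mul_of_nonneg_left (measureReal_mono hsub) ha
  have hlim : Tendsto (fun δ : ℝ => Real.exp (c * T) * (f 0 η₀ + T * (e + δ * (C + M)))) (𝓝[>] 0)
      (𝓝 (Real.exp (c * T) * (f 0 η₀ + e * T))) := by
    have h1 : Continuous fun δ : ℝ => Real.exp (c * T) * (f 0 η₀ + T * (e + δ * (C + M))) := by
      fun_prop
    have h2 := h1.tendsto 0
    rw [zero_mul, add_zero, mul_comm (T : ℝ) e] at h2
    exact h2.mono_left nhdsWithin_le_nhds
  exact ge_of_tendsto hlim (eventually_nhdsWithin_of_forall fun δ hδ => hbound δ hδ)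

end IsZeroRangeProcess

end

section

/-! ### Reflection of an integer-valued path -/

/-- The reflection at zero of the path `x + z`. -/
def reflect (x : ℤ) (z : ℝ≥0 → ℤ) (t : ℝ≥0) : ℤ :=
  max (x + z t) (sSup ((fun s => z t - z s) '' Set.Icc 0 t))

section Reflect

variable {x y b : ℤ} {z : ℝ≥0 → ℤ} {t t' : ℝ≥0}

/-- The workhorse for reflection: identities are proved by comparing upper bounds. The bound `b` is
needed because `sSup` of an unbounded set of integers is meaningless. -/
lemma reflect_le_iff (hb : ∀ s ≤ t, z t - z s ≤ b) :
    reflect x z t ≤ y ↔ x + z t ≤ y ∧ ∀ s ≤ t, z t - z s ≤ y := by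
  have hbdd : BddAbove ((fun s => z t - z s) '' Set.Icc 0 t) :=
    ⟨b, by rintro _ ⟨s, hs, rfl⟩; exact hb s hs.2⟩
  have hne : ((fun s => z t - z s) '' Set.Icc 0 t).Nonempty := ⟨_, t, ⟨zero_le, le_rfl⟩, rfl⟩
  rw [reflect, max_le_iff, csSup_le_iff hbdd hne]
  refine and_congr_right fun _ => ⟨fun h s hs => h _ ⟨s, ⟨zero_le, hs⟩, rfl⟩, ?_⟩
  rintro h _ ⟨s, hs, rfl⟩
  exact h s hs.2

lemma reflect_nonneg (hb : ∀ s ≤ t, z t - z s ≤ b) : 0 ≤ reflect x z t := by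
  have := ((reflect_le_iff (x := x) hb).1 le_rfl).2 t le_rfl
  linarith

/-- In this and the next two lemmas the free path makes at most one unit step. Times s after t add
to the supremum only values at most 0 or, after an upward step, at most 1; s = t' keeps the result
nonnegative after a downward step. -/
lemma reflect_eq_of_const (htt' : t ≤ t') (hb : ∀ s ≤ t, z t - z s ≤ b)
    (hb' : ∀ s ≤ t', z t' - z s ≤ b) (hz : ∀ s, t ≤ s → s ≤ t' → z s = z t) :
    reflect x z t' = reflect x z t := by
  refine eq_of_forall_ge_iff fun y => ?_
  rw [reflect_le_iff hb, reflect_le_iff hb', hz t' htt' le_rfl]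
  refine and_congr_right fun _ => ⟨fun h s hs => h s (hs.trans htt'), fun h s hs => ?_⟩
  rcases le_total s t with h1 | h1
  · exact h s h1
  · rw [hz s h1 hs]
    exact h t le_rfl

lemma reflect_eq_of_up (htt' : t ≤ t') (hb : ∀ s ≤ t, z t - z s ≤ b)
    (hb' : ∀ s ≤ t', z t' - z s ≤ b) (hz' : z t' = z t + 1) (hz : ∀ s, t ≤ s → s ≤ t' → z t ≤ z s) :
    reflect x z t' = reflect x z t + 1 := by
  refine eq_of_forall_ge_iff fun y => ?_
  rw [← le_sub_iff_add_le, reflect_le_iff hb, reflect_le_iff hb', hz']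
  constructor
  · rintro ⟨h1, h2⟩
    exact ⟨by linarith, fun s hs => by linarith [h2 s (hs.trans htt')]⟩
  · rintro ⟨h1, h2⟩
    refine ⟨by linarith, fun s hs => ?_⟩
    rcases le_total s t with h3 | h3
    · linarith [h2 s h3]
    · linarith [h2 t le_rfl, hz s h3 hs]

lemma reflect_eq_of_down (htt' : t ≤ t') (hb : ∀ s ≤ t, z t - z s ≤ b)
    (hb' : ∀ s ≤ t', z t' - z s ≤ b) (hz' : z t' = z t - 1)
    (hz : ∀ s, t ≤ s → s ≤ t' → z t' ≤ z s) :
    reflect x z t' = max (reflect x z t - 1) 0 := by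
  refine eq_of_forall_ge_iff fun y => ?_
  rw [max_le_iff, sub_le_iff_le_add, reflect_le_iff hb, reflect_le_iff hb']
  constructor
  · rintro ⟨h1, h2⟩
    exact ⟨⟨by linarith, fun s hs => by linarith [h2 s (hs.trans htt')]⟩, by
      linarith [h2 t' le_rfl]⟩
  · rintro ⟨⟨h1, h2⟩, h0⟩
    refine ⟨by linarith, fun s hs => ?_⟩
    rcases le_total s t with h3 | h3
    · linarith [h2 s h3]
    · linarith [hz s h3 hs]

/-- The reflection of a path observed at finitely many times, the last of which is current. -/
def gridReflect {N : ℕ} (x : ℤ) (z : Fin (N + 1) → ℤ) : ℤ :=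
  max (x + z (Fin.last N)) (Finset.univ.sup' Finset.univ_nonempty fun i => z (Fin.last N) - z i)

/-- A bounded supremum of integers is attained, at some s, and z is constant just to the right of s,
where fine grids have a point. Measurability and independence thereby reduce to finitely many times.
-/
lemma eventually_gridReflect_eq (hb : ∀ s ≤ t, z t - z s ≤ b)
    (hz : ∀ s, ∀ᶠ r in 𝓝[≥] s, z r = z s) :
    ∀ᶠ K : ℕ in atTop,
      gridReflect x (fun i : Fin (2 ^ K + 1) => z (i * (t / 2 ^ K))) = reflect x z t := by
  have hbdd : BddAbove ((fun s => z t - z s) '' Set.Icc 0 t) :=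
    ⟨b, by rintro _ ⟨s, hs, rfl⟩; exact hb s hs.2⟩
  have hne : ((fun s => z t - z s) '' Set.Icc 0 t).Nonempty := ⟨_, t, ⟨zero_le, le_rfl⟩, rfl⟩
  obtain ⟨s, hs, hsup⟩ := Int.csSup_mem hne hbdd
  obtain ⟨u, hu, hsubu⟩ := mem_nhdsGE_iff_exists_Ico_subset.1 (hz s)
  filter_upwards [eventually_exists_grid hs.2 hu] with K hK
  obtain ⟨i, hi, h1, h2⟩ := hK
  have hlast : ((Fin.last (2 ^ K) : Fin (2 ^ K + 1)) : ℕ) * (t / 2 ^ K) = t := by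
    rw [Fin.val_last]
    push_cast
    rw [mul_div_cancel₀ _ (by positivity)]
  simp only [gridReflect, reflect, hlast]
  congr 1
  refine le_antisymm ?_ ?_
  · refine Finset.sup'_le _ _ fun j _ => le_csSup hbdd ⟨_, ⟨zero_le, ?_⟩, rfl⟩
    have hj : ((j : ℕ) : ℝ≥0) ≤ 2 ^ K := by exact_mod_cast Nat.lt_succ_iff.1 j.2
    calc ((j : ℕ) : ℝ≥0) * (t / 2 ^ K) ≤ 2 ^ K * (t / 2 ^ K) := by gcongr
      _ = t := mul_div_cancel₀ _ (by positivity)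
  · rw [← hsup]
    have h3 : z (i * (t / 2 ^ K)) = z s := hsubu ⟨h1, h2⟩
    have h4 := Finset.le_sup' (s := Finset.univ) (fun j : Fin (2 ^ K + 1) =>
      z t - z (j * (t / 2 ^ K))) (Finset.mem_univ ⟨i, Nat.lt_succ_of_le hi⟩)
    simp only [h3] at h4
    exact h4

end Reflect

/-! ### Independence -/

section Independence

variable {Ω : Type*} [MeasurableSpace Ω] {P : Measure Ω} [IsProbabilityMeasure P]

/-- Associativity of the product of the three laws. -/
lemma IndepFun.prodMk_left_of_prodMk_right {α β γ : Type*} [MeasurableSpace α] [MeasurableSpace β]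
    [MeasurableSpace γ] {X : Ω → α} {Y : Ω → β} {Z : Ω → γ} (hX : Measurable X)
    (hY : Measurable Y) (hZ : Measurable Z) (h1 : IndepFun X (fun ω => (Y ω, Z ω)) P)
    (h2 : IndepFun Y Z P) : IndepFun (fun ω => (X ω, Y ω)) Z P := by
  have := Measure.isProbabilityMeasure_map (μ := P) hX.aemeasurable
  have := Measure.isProbabilityMeasure_map (μ := P) hY.aemeasurable
  have := Measure.isProbabilityMeasure_map (μ := P) hZ.aemeasurable
  have hXY : IndepFun X Y P := h1.comp measurable_id measurable_fst
  rw [indepFun_iff_map_prod_eq_prod_map_map (by fun_prop) (by fun_prop)] at h1 h2 hXY ⊢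
  rw [hXY]
  rw [h2, ← Measure.prodAssoc_prod] at h1
  have h3 := congrArg (Measure.map MeasurableEquiv.prodAssoc.symm) h1
  rw [Measure.map_map (by fun_prop) (by fun_prop), Measure.map_map (by fun_prop)
      (by fun_prop)] at h3
  simpa [Function.comp_def, MeasurableEquiv.prodAssoc] using h3

/-- If `A`, `(B₁, B₂)`, `(C₁, C₂)` are independent, as are `B₁`, `B₂` and `C₁`, `C₂`, then
`(A, B₁, C₁)` is independent of `(B₂, C₂)`. -/
lemma indepFun_past_future {α β₁ β₂ γ₁ γ₂ : Type*} [MeasurableSpace α] [MeasurableSpace β₁]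
    [MeasurableSpace β₂] [MeasurableSpace γ₁] [MeasurableSpace γ₂] {A : Ω → α} {B₁ : Ω → β₁}
    {B₂ : Ω → β₂} {C₁ : Ω → γ₁} {C₂ : Ω → γ₂} (hA : Measurable A) (hB₁ : Measurable B₁)
    (hB₂ : Measurable B₂) (hC₁ : Measurable C₁) (hC₂ : Measurable C₂)
    (h : IndepFun A (fun ω => ((B₁ ω, B₂ ω), (C₁ ω, C₂ ω))) P)
    (hBC : IndepFun (fun ω => (B₁ ω, B₂ ω)) (fun ω => (C₁ ω, C₂ ω)) P)
    (hB : IndepFun B₁ B₂ P) (hC : IndepFun C₁ C₂ P) :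
    IndepFun (fun ω => (A ω, B₁ ω, C₁ ω)) (fun ω => (B₂ ω, C₂ ω)) P := by
  have hC₂' : IndepFun (fun ω => (A ω, (B₁ ω, B₂ ω), C₁ ω)) C₂ P := by
    refine IndepFun.prodMk_left_of_prodMk_right (by fun_prop) (by fun_prop) (by fun_prop)
      (h.comp (φ := id) (ψ := fun p : (β₁ × β₂) × γ₁ × γ₂ => ((p.1, p.2.1), p.2.2)) measurable_id
          (by fun_prop)) ?_
    exact IndepFun.prodMk_left_of_prodMk_right (by fun_prop) (by fun_prop) (by fun_prop) hBC hC
  have hB₂' : IndepFun (fun ω => (A ω, C₁ ω, B₁ ω)) B₂ P := by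
    refine IndepFun.prodMk_left_of_prodMk_right (by fun_prop) (by fun_prop) (by fun_prop)
      (h.comp (φ := id) (ψ := fun p : (β₁ × β₂) × γ₁ × γ₂ =>
          ((p.2.1, p.1.1), p.1.2)) measurable_id (by fun_prop)) ?_
    exact IndepFun.prodMk_left_of_prodMk_right (by fun_prop) (by fun_prop) (by fun_prop)
      (hBC.symm.comp (φ := Prod.fst) (ψ := id) measurable_fst measurable_id) hB
  have h3 : IndepFun (fun ω => (C₂ ω, B₂ ω)) (fun ω => (A ω, B₁ ω, C₁ ω)) P := by
    refine IndepFun.prodMk_left_of_prodMk_right (by fun_prop) (by fun_prop) (by fun_prop) ?_ ?_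
    · exact hC₂'.symm.comp (φ := id) (ψ := fun p => (p.2.1.2, (p.1, p.2.1.1, p.2.2)))
        measurable_id (by fun_prop)
    · exact hB₂'.symm.comp (φ := id) (ψ := fun p => (p.1, p.2.2, p.2.1)) measurable_id (by fun_prop)
  exact (h3.comp (φ := Prod.swap) (ψ := id) measurable_swap measurable_id).symm

omit [IsProbabilityMeasure P] in
-- Since N starts at 0 and is monotone, its values along τ are partial sums of the earlier
-- increments.
lemma IsUnitPoissonProcess.indepFun_past {N : ℝ≥0 → Ω → ℕ} (hN : IsUnitPoissonProcess P N)
    {τ : ℕ → ℝ≥0} (hτ : Monotone τ) (hτ0 : τ 0 = 0) (K : ℕ) :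
    IndepFun (fun ω (i : Fin (K + 1)) => N (τ i) ω) (fun ω => N (τ (K + 1)) ω - N (τ K) ω) P := by
  have h1 := hN.indep_increments.nat hτ
  have hm (i : ℕ) : Measurable fun ω => N (τ (i + 1)) ω - N (τ i) ω :=
    (hN.measurable _).sub (hN.measurable _)
  have h2 := h1.indepFun_finset (Finset.range K) {K} (by simp) hm
  have hsum (i : ℕ) (ω : Ω) :
      N (τ i) ω = ∑ j ∈ Finset.range i, (N (τ (j + 1)) ω - N (τ j) ω) := by
    rw [Finset.sum_range_tsub (f := fun j => N (τ j) ω)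
      (fun a b hab => hN.monotone ω (hτ hab)), hτ0, hN.zero, tsub_zero]
  have hK : Measurable fun v : ({K} : Finset ℕ) → ℕ => v ⟨K, Finset.mem_singleton_self K⟩ :=
    measurable_pi_apply (⟨K, Finset.mem_singleton_self K⟩ : ({K} : Finset ℕ))
  have h3 := h2.comp
    (φ := fun (v : Finset.range K → ℕ) (i : Fin (K + 1)) => ∑ j : Finset.range K, if
        (j : ℕ) < i then v j else 0)
    (ψ := fun v : ({K} : Finset ℕ) → ℕ => v ⟨K, Finset.mem_singleton_self K⟩) (by
      refine measurable_pi_lambda _ fun i => Finset.measurable_sum _ fun j _ => ?_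
      split_ifs
      · exact measurable_pi_apply _
      · exact measurable_const) hK
  convert h3 using 1
  · funext ω i
    simp only [Function.comp_apply]
    rw [hsum, Finset.univ_eq_attach, Finset.sum_attach (Finset.range K)
      (fun j => if j < (i : ℕ) then N (τ (j + 1)) ω - N (τ j) ω else 0), ← Finset.sum_filter]
    congr 1
    ext j
    simp only [Finset.mem_range, Finset.mem_filter]
    omega
  · rfl

end Independence

end

section

/-! ### Laws of pairs as profiles -/

/-- The profile of point masses of a finite measure. -/
def massProfile (ν : Measure (ℕ × ℕ)) [IsFiniteMeasure ν] : Profile ℕ :=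
  Profile.mk (fun x => ν.real {x}) (ν.real Set.univ) fun s => by
    simp_rw [abs_of_nonneg measureReal_nonneg]
    rw [sum_measureReal_singleton]
    exact measureReal_mono (Set.subset_univ _)

section LawOn

variable {Ω : Type*} [MeasurableSpace Ω] (P : Measure Ω) [IsProbabilityMeasure P]

/-- The law of `Y` on the event `E`, as a profile. -/
def lawOn (Y : Ω → ℕ × ℕ) (E : Set Ω) : Profile ℕ := massProfile ((P.restrict E).map Y)

variable {P} {Y Y' : Ω → ℕ × ℕ} {E F : Set Ω}

lemma lawOn_apply (hY : Measurable Y) (x : ℕ × ℕ) :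
    lawOn P Y E x = P.real (Y ⁻¹' {x} ∩ E) := by
  have h : lawOn P Y E x = ((P.restrict E).map Y).real {x} := rfl
  rw [h, map_measureReal_apply hY (measurableSet_singleton x),
    measureReal_restrict_apply (hY (measurableSet_singleton x))]

lemma norm_lawOn_le (hY : Measurable Y) : ‖lawOn P Y E‖ ≤ P.real E := by
  refine Profile.norm_le_of_sum_abs_le fun s => ?_
  have h (x : ℕ × ℕ) : lawOn P Y E x = ((P.restrict E).map Y).real {x} := rfl
  simp_rw [h, abs_of_nonneg measureReal_nonneg]
  rw [sum_measureReal_singleton, map_measureReal_apply hY s.measurableSet,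
    measureReal_restrict_apply (hY s.measurableSet)]
  exact measureReal_mono Set.inter_subset_right

lemma lawOn_union (hY : Measurable Y) (hF : MeasurableSet F) (hEF : Disjoint E F) :
    lawOn P Y (E ∪ F) = lawOn P Y E + lawOn P Y F := by
  ext x
  rw [lp.coeFn_add, Pi.add_apply, lawOn_apply hY, lawOn_apply hY, lawOn_apply hY,
    Set.inter_union_distrib_left, measureReal_union _ ((hY (measurableSet_singleton x)).inter hF)]
  exact hEF.mono Set.inter_subset_right Set.inter_subset_right

lemma lawOn_eq_smul (hY : Measurable Y)
    (h : ∀ x, P.real (Y ⁻¹' {x} ∩ E) = P.real (Y ⁻¹' {x}) * P.real E) :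
    lawOn P Y E = P.real E • lawOn P Y Set.univ := by
  ext x
  rw [lp.coeFn_smul, Pi.smul_apply, smul_eq_mul, lawOn_apply hY, lawOn_apply hY, h,
    Set.inter_univ, mul_comm]

lemma lawOn_congr (hY : Measurable Y) (hY' : Measurable Y') (h : ∀ ω ∈ E, Y' ω = Y ω) :
    lawOn P Y' E = lawOn P Y E := by
  ext x
  rw [lawOn_apply hY, lawOn_apply hY']
  congr 1
  ext ω
  simp only [Set.mem_inter_iff, Set.mem_preimage]
  exact and_congr_left fun hω => by rw [h ω hω]

/-- Pushing forward along l ↦ l + 1 is the upward shift, that is, the identity plus `birth`. -/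
lemma lawOn_up (hY : Measurable Y) (hY' : Measurable Y')
    (h : ∀ ω ∈ E, Y' ω = ((Y ω).1, (Y ω).2 + 1)) :
    lawOn P Y' E = lawOn P Y E + birth ℕ (lawOn P Y E) := by
  ext ⟨k, l⟩
  rw [lp.coeFn_add, Pi.add_apply, birth_apply, add_sub_cancel, lawOn_apply hY']
  cases l with
  | zero =>
    have : Y' ⁻¹' {(k, 0)} ∩ E = ∅ := by
      ext ω
      simp only [Set.mem_inter_iff, Set.mem_preimage, Set.mem_singleton_iff,
        Set.mem_empty_iff_false, iff_false, not_and]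
      intro h1 h2
      rw [h ω h2] at h1
      simp at h1
    rw [this]
    simp
  | succ l =>
    rw [if_pos (by omega), lawOn_apply hY]
    congr 1
    ext ω
    simp only [Set.mem_inter_iff, Set.mem_preimage, Set.mem_singleton_iff]
    refine and_congr_left fun hω => ?_
    rw [h ω hω]
    simp [Prod.ext_iff]

/-- Truncated subtraction keeps 0 at 0, exactly as `death` does. -/
lemma lawOn_down (hY : Measurable Y) (hY' : Measurable Y') (hE : MeasurableSet E)
    (h : ∀ ω ∈ E, Y' ω = ((Y ω).1, (Y ω).2 - 1)) :
    lawOn P Y' E = lawOn P Y E + death ℕ (lawOn P Y E) := by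
  ext ⟨k, l⟩
  rw [lp.coeFn_add, Pi.add_apply, death_apply, lawOn_apply hY']
  cases l with
  | zero =>
    rw [if_neg (by omega), sub_zero, lawOn_apply hY, lawOn_apply hY, ← measureReal_union]
    · congr 1
      ext ω
      simp only [Set.mem_inter_iff, Set.mem_preimage, Set.mem_singleton_iff, Set.mem_union]
      rw [← or_and_right]
      refine and_congr_left fun hω => ?_
      rw [h ω hω]
      simp only [Prod.ext_iff]
      omega
    · refine Set.disjoint_left.2 fun ω h1 h2 => ?_
      have e1 : Y ω = (k, 0) := h1.1
      have e2 : Y ω = (k, 0 + 1) := h2.1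
      rw [e1] at e2
      simp at e2
    · exact (hY (measurableSet_singleton _)).inter hE
  | succ l =>
    rw [if_pos (by omega), add_sub_cancel, lawOn_apply hY]
    congr 1
    ext ω
    simp only [Set.mem_inter_iff, Set.mem_preimage, Set.mem_singleton_iff]
    refine and_congr_left fun hω => ?_
    rw [h ω hω]
    simp only [Prod.ext_iff]
    omega

end LawOn

/-! ### The clock of the birth process -/

/-- The time change `∫_0^t (1 - 𝔮_0(s)) ds`. -/
def fluidClock (𝔮 : ℝ → ℕ → ℝ) (t : ℝ≥0) : ℝ≥0 :=
  (∫ s in (0 : ℝ)..t, (1 - 𝔮 s 0)).toNNReal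

namespace IsFluidSolution

variable {q : ℕ → ℝ} {𝔮 : ℝ → ℕ → ℝ}

lemma intervalIntegrable (h : IsFluidSolution q 𝔮) {s t : ℝ} (hs : 0 ≤ s) (hst : s ≤ t) :
    IntervalIntegrable (fun u => 1 - 𝔮 u 0) volume s t := by
  refine ContinuousOn.intervalIntegrable ?_
  rw [Set.uIcc_of_le hst]
  exact continuousOn_const.sub fun u hu => ((h.deriv 0 u (hs.trans hu.1)).mono fun r hr =>
    hs.trans hr.1).continuousWithinAt

lemma coe_fluidClock (h : IsFluidSolution q 𝔮) (t : ℝ≥0) :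
    (fluidClock 𝔮 t : ℝ) = ∫ s in (0 : ℝ)..t, (1 - 𝔮 s 0) := by
  rw [fluidClock, Real.coe_toNNReal]
  exact intervalIntegral.integral_nonneg t.coe_nonneg fun u hu => sub_nonneg.2
      ((h.isProb u hu.1).le_one 0)

lemma fluidClock_sub (h : IsFluidSolution q 𝔮) (s t : ℝ≥0) :
    (fluidClock 𝔮 t : ℝ) - fluidClock 𝔮 s = ∫ u in (s : ℝ)..t, (1 - 𝔮 u 0) := by
  rw [h.coe_fluidClock, h.coe_fluidClock, intervalIntegral.integral_interval_sub_left
    (h.intervalIntegrable le_rfl t.coe_nonneg) (h.intervalIntegrable le_rfl s.coe_nonneg)]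

lemma fluidClock_mono (h : IsFluidSolution q 𝔮) : Monotone (fluidClock 𝔮) := by
  intro s t hst
  rw [← NNReal.coe_le_coe, ← sub_nonneg, h.fluidClock_sub]
  exact intervalIntegral.integral_nonneg (by exact_mod_cast hst) fun u hu =>
    sub_nonneg.2 ((h.isProb u (s.coe_nonneg.trans hu.1)).le_one 0)

lemma fluidClock_sub_le (h : IsFluidSolution q 𝔮) {s t : ℝ≥0} (hst : s ≤ t) :
    (fluidClock 𝔮 t : ℝ) - fluidClock 𝔮 s ≤ t - s := by
  have hst' : (s : ℝ) ≤ t := by exact_mod_cast hst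
  rw [h.fluidClock_sub]
  have h1 : ∫ u in (s : ℝ)..t, (1 - 𝔮 u 0) ≤ ∫ u in (s : ℝ)..t, (1 : ℝ) :=
    intervalIntegral.integral_mono_on hst' (h.intervalIntegrable s.coe_nonneg hst')
      intervalIntegrable_const fun u hu => sub_le_self _
          ((h.isProb u (s.coe_nonneg.trans hu.1)).1 0)
  simpa using h1

/-- Freeze the rate at time s; 𝔮₀ is 4-Lipschitz. -/
lemma abs_fluidClock_sub_sub_le (h : IsFluidSolution q 𝔮) {s t : ℝ≥0} (hst : s ≤ t) :
    |(fluidClock 𝔮 t : ℝ) - fluidClock 𝔮 s - (t - s) * (1 - 𝔮 s 0)| ≤ 4 * ((t : ℝ) - s) ^ 2 := by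
  have hst' : (s : ℝ) ≤ t := by exact_mod_cast hst
  have h1 : (fluidClock 𝔮 t : ℝ) - fluidClock 𝔮 s - (t - s) * (1 - 𝔮 s 0) =
      ∫ u in (s : ℝ)..t, ((1 - 𝔮 u 0) - (1 - 𝔮 s 0)) := by
    rw [intervalIntegral.integral_sub
        (h.intervalIntegrable s.coe_nonneg hst') intervalIntegrable_const,
      h.fluidClock_sub]
    simp
    ring
  rw [h1]
  have h2 := intervalIntegral.norm_integral_le_of_norm_le_const (a := (s : ℝ)) (b := t)
    (C := 4 * ((t : ℝ) - s)) (f := fun u => (1 - 𝔮 u 0) - (1 - 𝔮 s 0)) (by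
      intro u hu
      rw [Set.uIoc_of_le hst'] at hu
      rw [Real.norm_eq_abs, sub_sub_sub_cancel_left, abs_sub_comm]
      have h3 := h.abs_sub_le s.coe_nonneg hu.1.le 0
      have h4 := hu.2
      linarith)
  rw [Real.norm_eq_abs, abs_of_nonneg (sub_nonneg.2 hst')] at h2
  linarith

lemma continuous_fluidClock (h : IsFluidSolution q 𝔮) : Continuous (fluidClock 𝔮) := by
  refine (LipschitzWith.of_dist_le_mul (K := 1) fun a b => ?_).continuous
  have key {a b : ℝ≥0} (hab : a ≤ b) :
      |(fluidClock 𝔮 b : ℝ) - fluidClock 𝔮 a| ≤ |(b : ℝ) - a| := by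
    have h1 : (fluidClock 𝔮 a : ℝ) ≤ fluidClock 𝔮 b := by exact_mod_cast h.fluidClock_mono hab
    rw [abs_of_nonneg (sub_nonneg.2 h1)]
    exact (h.fluidClock_sub_le hab).trans (le_abs_self _)
  rw [NNReal.dist_eq, NNReal.dist_eq, NNReal.coe_one, one_mul]
  rcases le_total a b with hab | hab
  · rw [abs_sub_comm, abs_sub_comm (a : ℝ)]
    exact key hab
  · exact key hab

end IsFluidSolution

@[simp]
lemma fluidClock_zero (𝔮 : ℝ → ℕ → ℝ) : fluidClock 𝔮 0 = 0 := by simp [fluidClock]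

/-! ### The law of the fluid process -/

/-- The ingredients of the fluid process. -/
structure IsFluidInput {Ω : Type*} [MeasurableSpace Ω] (P : Measure Ω) (q : ℕ → ℝ)
    (𝔮 : ℝ → ℕ → ℝ) (Ξp Ξm : ℝ≥0 → Ω → ℕ) (X₀ : Ω → ℕ) : Prop where
  sol : IsFluidSolution q 𝔮
  birth : IsUnitPoissonProcess P Ξp
  death : IsUnitPoissonProcess P Ξm
  measurable : Measurable X₀
  law : ∀ k, P.real {ω | X₀ ω = k} = q k
  indep : IndepFun (fun ω t => Ξp t ω) (fun ω t => Ξm t ω) P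
  indep_initial : IndepFun X₀ (fun ω => ((fun t => Ξp t ω), (fun t => Ξm t ω))) P

/-- The initial and current states of the fluid process. -/
def fluidPair {Ω : Type*} (𝔮 : ℝ → ℕ → ℝ) (Ξp Ξm : ℝ≥0 → Ω → ℕ) (X₀ : Ω → ℕ) (t : ℝ≥0) (ω : Ω) :
    ℕ × ℕ :=
  (X₀ ω, (fluidProcess 𝔮 Ξp Ξm X₀ t ω).toNat)

namespace IsFluidInput

variable {Ω : Type*} {q : ℕ → ℝ} {𝔮 : ℝ → ℕ → ℝ} {Ξp Ξm : ℝ≥0 → Ω → ℕ} {X₀ : Ω → ℕ}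

lemma fluidInput_eq (t : ℝ≥0) (ω : Ω) :
    fluidInput 𝔮 Ξp Ξm t ω = (Ξp (fluidClock 𝔮 t) ω : ℤ) - Ξm t ω := rfl

lemma fluidProcess_eq (t : ℝ≥0) (ω : Ω) : fluidProcess 𝔮 Ξp Ξm X₀ t ω =
    reflect (X₀ ω) (fun s => fluidInput 𝔮 Ξp Ξm s ω) t := rfl

variable [MeasurableSpace Ω] {P : Measure Ω}

lemma fluidInput_sub_le (h : IsFluidInput P q 𝔮 Ξp Ξm X₀) (ω : Ω) {t T : ℝ≥0} (htT : t ≤ T) :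
    ∀ s ≤ t, fluidInput 𝔮 Ξp Ξm t ω - fluidInput 𝔮 Ξp Ξm s ω ≤ Ξp (fluidClock 𝔮 T) ω := by
  intro s hs
  rw [fluidInput_eq, fluidInput_eq]
  have h1 := h.birth.monotone ω (h.sol.fluidClock_mono htT)
  have h2 := h.death.monotone ω hs
  simp only at h1 h2
  omega

lemma fluidInput_right_continuous (h : IsFluidInput P q 𝔮 Ξp Ξm X₀) (ω : Ω) (s : ℝ≥0) :
    ∀ᶠ r in 𝓝[≥] s, fluidInput 𝔮 Ξp Ξm r ω = fluidInput 𝔮 Ξp Ξm s ω := by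
  have h1 : Tendsto (fluidClock 𝔮) (𝓝[≥] s) (𝓝[≥] (fluidClock 𝔮 s)) :=
    tendsto_nhdsWithin_iff.2 ⟨h.sol.continuous_fluidClock.continuousWithinAt,
      eventually_nhdsWithin_of_forall fun r hr => h.sol.fluidClock_mono hr⟩
  filter_upwards [h1.eventually (h.birth.right_continuous ω _), h.death.right_continuous ω s]
    with r h2 h3
  rw [fluidInput_eq, fluidInput_eq, h2, h3]

lemma fluidProcess_nonneg (h : IsFluidInput P q 𝔮 Ξp Ξm X₀) (t : ℝ≥0) (ω : Ω) :
    0 ≤ fluidProcess 𝔮 Ξp Ξm X₀ t ω :=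
  reflect_nonneg (x := X₀ ω) (z := fun s => fluidInput 𝔮 Ξp Ξm s ω)
    (h.fluidInput_sub_le ω (le_refl t))

lemma fluidProcess_zero (h : IsFluidInput P q 𝔮 Ξp Ξm X₀) (ω : Ω) :
    fluidProcess 𝔮 Ξp Ξm X₀ 0 ω = X₀ ω := by
  have h0 : fluidInput 𝔮 Ξp Ξm 0 ω = 0 := by
    rw [fluidInput_eq, fluidClock_zero, h.birth.zero, h.death.zero]
    rfl
  refine eq_of_forall_ge_iff fun y => ?_
  rw [fluidProcess_eq, reflect_le_iff (h.fluidInput_sub_le ω le_rfl)]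
  simp only [nonpos_iff_eq_zero, forall_eq, h0, add_zero, sub_zero]
  omega

/-- The driving variables observed along a dyadic grid. -/
def gridInput (𝔮 : ℝ → ℕ → ℝ) (Ξp Ξm : ℝ≥0 → Ω → ℕ) (X₀ : Ω → ℕ) (t : ℝ≥0) (K : ℕ) (ω : Ω) :
    ℕ × (Fin (2 ^ K + 1) → ℕ) × (Fin (2 ^ K + 1) → ℕ) :=
  (X₀ ω, (fun i => Ξp (fluidClock 𝔮 ((i : ℕ) * (t / 2 ^ K))) ω), fun i => Ξm
      ((i : ℕ) * (t / 2 ^ K)) ω)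

/-- The pair of initial and reflected states as a function of grid observations. -/
def gridPair (K : ℕ) (a : ℕ × (Fin (2 ^ K + 1) → ℕ) × (Fin (2 ^ K + 1) → ℕ)) : ℕ × ℕ :=
  (a.1, (gridReflect a.1 fun i => (a.2.1 i : ℤ) - a.2.2 i).toNat)

lemma eventually_gridPair_eq (h : IsFluidInput P q 𝔮 Ξp Ξm X₀) (t : ℝ≥0) (ω : Ω) :
    ∀ᶠ K in atTop, gridPair K (gridInput 𝔮 Ξp Ξm X₀ t K ω) = fluidPair 𝔮 Ξp Ξm X₀ t ω := by
  filter_upwards [eventually_gridReflect_eq (x := X₀ ω) (h.fluidInput_sub_le ω (le_refl t))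
    (h.fluidInput_right_continuous ω)] with K hK
  rw [fluidPair, fluidProcess_eq, ← hK]
  rfl

lemma measurable_gridInput (h : IsFluidInput P q 𝔮 Ξp Ξm X₀) (t : ℝ≥0) (K : ℕ) :
    Measurable (gridInput 𝔮 Ξp Ξm X₀ t K) :=
  h.measurable.prodMk ((measurable_pi_lambda _ fun _ => h.birth.measurable _).prodMk
    (measurable_pi_lambda _ fun _ => h.death.measurable _))

/-- The supremum over uncountably many times is a pointwise limit of functions of grid observations.
-/
lemma measurable_fluidPair (h : IsFluidInput P q 𝔮 Ξp Ξm X₀) (t : ℝ≥0) :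
    Measurable (fluidPair 𝔮 Ξp Ξm X₀ t) := by
  refine measurable_to_countable' fun x => ?_
  refine measurableSet_of_tendsto_indicator atTop
    (As := fun K => (fun ω => gridPair K (gridInput 𝔮 Ξp Ξm X₀ t K ω)) ⁻¹' {x}) (fun K => ?_)
    fun ω => ?_
  · exact ((measurable_of_countable (gridPair K)).comp (h.measurable_gridInput t K))
      (measurableSet_singleton x)
  · filter_upwards [h.eventually_gridPair_eq t ω] with K hK
    simp only [Set.mem_preimage, hK]

/-- The numbers of births and deaths proposed in `(t, t']`. -/
def proposals (𝔮 : ℝ → ℕ → ℝ) (Ξp Ξm : ℝ≥0 → Ω → ℕ) (t t' : ℝ≥0) (ω : Ω) : ℕ × ℕ :=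
  (Ξp (fluidClock 𝔮 t') ω - Ξp (fluidClock 𝔮 t) ω, Ξm t' ω - Ξm t ω)

lemma measurable_proposals (h : IsFluidInput P q 𝔮 Ξp Ξm X₀) (t t' : ℝ≥0) :
    Measurable (proposals 𝔮 Ξp Ξm t t') :=
  ((h.birth.measurable _).sub (h.birth.measurable _)).prodMk
    ((h.death.measurable _).sub (h.death.measurable _))

lemma indepFun_gridInput [IsProbabilityMeasure P] (h : IsFluidInput P q 𝔮 Ξp Ξm X₀) {t t' : ℝ≥0}
    (htt' : t ≤ t') (K : ℕ) :
    IndepFun (gridInput 𝔮 Ξp Ξm X₀ t K) (proposals 𝔮 Ξp Ξm t t') P := by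
  -- σ runs through the grid of [0, t] and then jumps to t', so that the increment after the last
  -- grid time is the vector of proposals.
  set σ : ℕ → ℝ≥0 := fun i => if i ≤ 2 ^ K then i * (t / 2 ^ K) else t' with hσ
  have hσle {i : ℕ} (hi : i ≤ 2 ^ K) : σ i = i * (t / 2 ^ K) := if_pos hi
  have hσt : σ (2 ^ K) = t := by
    rw [hσle le_rfl]
    push_cast
    exact mul_div_cancel₀ _ (by positivity)
  have hσt' : σ (2 ^ K + 1) = t' := if_neg (by omega)
  have hσm : Monotone σ := by
    refine monotone_nat_of_le_succ fun i => ?_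
    by_cases hi : i + 1 ≤ 2 ^ K
    · rw [hσle hi, hσle (by omega)]
      gcongr
      exact i.le_succ
    · have h1 : σ (i + 1) = t' := if_neg hi
      rw [h1]
      by_cases hi' : i ≤ 2 ^ K
      · have : i = 2 ^ K := by omega
        rw [this, hσt]
        exact htt'
      · exact (if_neg hi').le
  have hσ0 : σ 0 = 0 := by simp [hσ]
  have hB := h.birth.indepFun_past (τ := fun i => fluidClock 𝔮 (σ i))
    (h.sol.fluidClock_mono.comp hσm) (by rw [hσ0, fluidClock_zero]) (2 ^ K)
  have hC := h.death.indepFun_past hσm hσ0 (2 ^ K)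
  have key := indepFun_past_future (P := P) (A := X₀)
    (B₁ := fun ω (i : Fin (2 ^ K + 1)) => Ξp (fluidClock 𝔮 (σ i)) ω)
    (B₂ := fun ω => Ξp (fluidClock 𝔮 (σ (2 ^ K + 1))) ω - Ξp (fluidClock 𝔮 (σ (2 ^ K))) ω)
    (C₁ := fun ω (i : Fin (2 ^ K + 1)) => Ξm (σ i) ω)
    (C₂ := fun ω => Ξm (σ (2 ^ K + 1)) ω - Ξm (σ (2 ^ K)) ω)
    h.measurable (measurable_pi_lambda _ fun _ => h.birth.measurable _)
    ((h.birth.measurable _).sub (h.birth.measurable _))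
    (measurable_pi_lambda _ fun _ => h.death.measurable _)
    ((h.death.measurable _).sub (h.death.measurable _))
    (h.indep_initial.comp (φ := id) (ψ := fun p : (ℝ≥0 → ℕ) × (ℝ≥0 → ℕ) =>
      (((fun i : Fin (2 ^ K + 1) => p.1 (fluidClock 𝔮 (σ i))),
        p.1 (fluidClock 𝔮 (σ (2 ^ K + 1))) - p.1 (fluidClock 𝔮 (σ (2 ^ K)))),
      ((fun i : Fin (2 ^ K + 1) => p.2 (σ i)), p.2 (σ (2 ^ K + 1)) - p.2 (σ (2 ^ K)))))
      measurable_id (by fun_prop))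
    (h.indep.comp (φ := fun p : ℝ≥0 → ℕ => ((fun i : Fin (2 ^ K + 1) => p (fluidClock 𝔮 (σ i))),
        p (fluidClock 𝔮 (σ (2 ^ K + 1))) - p (fluidClock 𝔮 (σ (2 ^ K)))))
      (ψ := fun p : ℝ≥0 → ℕ =>
        ((fun i : Fin (2 ^ K + 1) => p (σ i)), p (σ (2 ^ K + 1)) - p (σ (2 ^ K))))
      (by fun_prop) (by fun_prop)) hB hC
  have hi (i : Fin (2 ^ K + 1)) : σ i = i * (t / 2 ^ K) := hσle (Nat.lt_succ_iff.1 i.2)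
  simp only [hi, hσt, hσt'] at key
  exact key

/-- Independence of the present state from the future proposals, passed to the limit from the grid
approximations. -/
lemma measureReal_fluidPair_inter [IsProbabilityMeasure P] (h : IsFluidInput P q 𝔮 Ξp Ξm X₀)
    {t t' : ℝ≥0} (htt' : t ≤ t')
    (x : ℕ × ℕ) (S : Set (ℕ × ℕ)) :
    P.real (fluidPair 𝔮 Ξp Ξm X₀ t ⁻¹' {x} ∩ proposals 𝔮 Ξp Ξm t t' ⁻¹' S) =
      P.real (fluidPair 𝔮 Ξp Ξm X₀ t ⁻¹' {x}) * P.real (proposals 𝔮 Ξp Ξm t t' ⁻¹' S) := by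
  set Y : ℕ → Ω → ℕ × ℕ := fun K ω => gridPair K (gridInput 𝔮 Ξp Ξm X₀ t K ω)
  have hY (K : ℕ) : Measurable (Y K) :=
    (measurable_of_countable (gridPair K)).comp (h.measurable_gridInput t K)
  have hS : MeasurableSet (proposals 𝔮 Ξp Ξm t t' ⁻¹' S) :=
    h.measurable_proposals t t' S.to_countable.measurableSet
  have hlim1 : Tendsto (fun K => P.real (Y K ⁻¹' {x} ∩ proposals 𝔮 Ξp Ξm t t' ⁻¹' S)) atTop
      (𝓝 (P.real (fluidPair 𝔮 Ξp Ξm X₀ t ⁻¹' {x} ∩ proposals 𝔮 Ξp Ξm t t' ⁻¹' S))) := by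
    refine (ENNReal.tendsto_toReal (measure_ne_top _ _)).comp
      (tendsto_measure_of_tendsto_indicator_of_isFiniteMeasure atTop P
        (fun K => (hY K (measurableSet_singleton x)).inter hS) fun ω => ?_)
    filter_upwards [h.eventually_gridPair_eq t ω] with K hK
    simp only [Set.mem_inter_iff, Set.mem_preimage, Y, hK]
  have hlim2 : Tendsto (fun K => P.real (Y K ⁻¹' {x})) atTop
      (𝓝 (P.real (fluidPair 𝔮 Ξp Ξm X₀ t ⁻¹' {x}))) := by
    refine (ENNReal.tendsto_toReal (measure_ne_top _ _)).comp
      (tendsto_measure_of_tendsto_indicator_of_isFiniteMeasure atTop P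
        (fun K => hY K (measurableSet_singleton x)) fun ω => ?_)
    filter_upwards [h.eventually_gridPair_eq t ω] with K hK
    simp only [Set.mem_preimage, Y, hK]
  refine tendsto_nhds_unique hlim1 ((hlim2.mul_const _).congr fun K => ?_)
  have hind : IndepFun (Y K) (proposals 𝔮 Ξp Ξm t t') P :=
    (h.indepFun_gridInput htt' K).comp (φ := gridPair K) (ψ := id)
      (measurable_of_countable _) measurable_id
  have := hind.measure_inter_preimage_eq_mul {x} S (measurableSet_singleton x)
    S.to_countable.measurableSet
  simp only [measureReal_def, this, ENNReal.toReal_mul]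

lemma measureReal_proposals (h : IsFluidInput P q 𝔮 Ξp Ξm X₀) {t t' : ℝ≥0} (htt' : t ≤ t')
    (a b : ℕ) :
    P.real (proposals 𝔮 Ξp Ξm t t' ⁻¹' {(a, b)}) =
      (poissonMeasure (fluidClock 𝔮 t' - fluidClock 𝔮 t)).real {a} *
        (poissonMeasure (t' - t)).real {b} := by
  have hind : IndepFun (fun ω => Ξp (fluidClock 𝔮 t') ω - Ξp (fluidClock 𝔮 t) ω)
      (fun ω => Ξm t' ω - Ξm t ω) P :=
    h.indep.comp (φ := fun p : ℝ≥0 → ℕ => p (fluidClock 𝔮 t') - p (fluidClock 𝔮 t))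
      (ψ := fun p : ℝ≥0 → ℕ => p t' - p t) (by fun_prop) (by fun_prop)
  have h1 := hind.measure_inter_preimage_eq_mul {a} {b} (measurableSet_singleton a)
    (measurableSet_singleton b)
  have hBm : Measurable fun ω => Ξp (fluidClock 𝔮 t') ω - Ξp (fluidClock 𝔮 t) ω :=
    (h.birth.measurable _).sub (h.birth.measurable _)
  have hCm : Measurable fun ω => Ξm t' ω - Ξm t ω := (h.death.measurable _).sub
      (h.death.measurable _)
  rw [← h.birth.law_increments _ _ (h.sol.fluidClock_mono htt'),
    ← h.death.law_increments _ _ htt', map_measureReal_apply hBm (measurableSet_singleton a),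
    map_measureReal_apply hCm (measurableSet_singleton b)]
  simp only [measureReal_def, ← ENNReal.toReal_mul]
  rw [← h1]
  congr 2
  ext ω
  simp [proposals]

end IsFluidInput

end

/-! ### The forward equation for the joint law, and its tightness -/

section

/-- Here d is the elapsed time and x the elapsed birth clock. The first bound is (1 - u)(1 + u) = 1
- u² with u = x + d ≤ 2d; the others use 1 - exp(-u) ≤ u. -/
lemma poisson_one_step {x d c : ℝ} (hx : 0 ≤ x) (hxd : x ≤ d) (hc : |x - d * c| ≤ 4 * d ^ 2) :
    1 - (Real.exp (-x) * Real.exp (-d) + Real.exp (-x) * x * Real.exp (-d) +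
      Real.exp (-x) * (Real.exp (-d) * d)) ≤ 4 * d ^ 2 ∧
    |Real.exp (-x) * x * Real.exp (-d) - d * c| ≤ 6 * d ^ 2 ∧
    |Real.exp (-x) * (Real.exp (-d) * d) - d| ≤ 2 * d ^ 2 := by
  have he : Real.exp (-x) * Real.exp (-d) = Real.exp (-(x + d)) := by
    rw [← Real.exp_add]
    ring_nf
  have h1 : 1 - (x + d) ≤ Real.exp (-(x + d)) := by linarith [Real.add_one_le_exp (-(x + d))]
  have h2 : Real.exp (-(x + d)) ≤ 1 := Real.exp_le_one_iff.2 (by linarith)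
  have e1 : Real.exp (-x) * x * Real.exp (-d) = x * Real.exp (-(x + d)) := by rw [← he]; ring
  have e2 : Real.exp (-x) * (Real.exp (-d) * d) = d * Real.exp (-(x + d)) := by rw [← he]; ring
  rw [e1, e2, he]
  set y := Real.exp (-(x + d))
  have hd : 0 ≤ d := hx.trans hxd
  have hxx : x * (x + d) ≤ 2 * d ^ 2 := by nlinarith
  refine ⟨?_, ?_, ?_⟩
  · have h3 := mul_le_mul_of_nonneg_right h1 (by linarith : 0 ≤ 1 + (x + d))
    nlinarith
  · have h3 : |x * y - x| ≤ 2 * d ^ 2 := by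
      rw [abs_le]
      constructor <;> nlinarith
    calc |x * y - d * c| = |(x * y - x) + (x - d * c)| := by ring_nf
      _ ≤ |x * y - x| + |x - d * c| := abs_add_le _ _
      _ ≤ 6 * d ^ 2 := by linarith
  · rw [abs_le]
    constructor <;> nlinarith

/-- The joint law of the initial and current states of the fluid process. -/
def fluidLaw {Ω : Type*} [MeasurableSpace Ω] (P : Measure Ω) [IsProbabilityMeasure P]
    (𝔮 : ℝ → ℕ → ℝ) (Ξp Ξm : ℝ≥0 → Ω → ℕ) (X₀ : Ω → ℕ) (t : ℝ≥0) : Profile ℕ :=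
  lawOn P (fluidPair 𝔮 Ξp Ξm X₀ t) Set.univ

namespace IsFluidInput

variable {Ω : Type*} [MeasurableSpace Ω] {P : Measure Ω} {q : ℕ → ℝ}
  {𝔮 : ℝ → ℕ → ℝ} {Ξp Ξm : ℝ≥0 → Ω → ℕ} {X₀ : Ω → ℕ}

/-- The effect of the proposals in `(t, t']` when there is at most one of them. -/
lemma fluidProcess_eq_of_proposals (h : IsFluidInput P q 𝔮 Ξp Ξm X₀) {t t' : ℝ≥0} (htt' : t ≤ t')
    (ω : Ω) :
    (proposals 𝔮 Ξp Ξm t t' ω = (0, 0) →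
      fluidProcess 𝔮 Ξp Ξm X₀ t' ω = fluidProcess 𝔮 Ξp Ξm X₀ t ω) ∧
    (proposals 𝔮 Ξp Ξm t t' ω = (1, 0) →
      fluidProcess 𝔮 Ξp Ξm X₀ t' ω = fluidProcess 𝔮 Ξp Ξm X₀ t ω + 1) ∧
    (proposals 𝔮 Ξp Ξm t t' ω = (0, 1) →
      fluidProcess 𝔮 Ξp Ξm X₀ t' ω = max (fluidProcess 𝔮 Ξp Ξm X₀ t ω - 1) 0) := by
  have hb := h.fluidInput_sub_le ω htt'
  have hb' := h.fluidInput_sub_le ω (le_refl t')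
  have hmono : ∀ s, t ≤ s → s ≤ t' →
      Ξp (fluidClock 𝔮 t) ω ≤ Ξp (fluidClock 𝔮 s) ω ∧
      Ξp (fluidClock 𝔮 s) ω ≤ Ξp (fluidClock 𝔮 t') ω ∧ Ξm t ω ≤ Ξm s ω ∧ Ξm s ω ≤ Ξm t' ω :=
    fun s h1 h2 => ⟨h.birth.monotone ω (h.sol.fluidClock_mono h1),
      h.birth.monotone ω (h.sol.fluidClock_mono h2), h.death.monotone ω h1, h.death.monotone ω h2⟩
  have ht := hmono t' htt' le_rfl
  simp only [proposals, Prod.mk.injEq, fluidProcess_eq]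
  refine ⟨fun hp => ?_, fun hp => ?_, fun hp => ?_⟩
  · refine reflect_eq_of_const (z := fun s => fluidInput 𝔮 Ξp Ξm s ω) htt' hb hb'
      fun s h1 h2 => ?_
    have := hmono s h1 h2
    simp only [fluidInput_eq]
    omega
  · refine reflect_eq_of_up (z := fun s => fluidInput 𝔮 Ξp Ξm s ω) htt' hb hb' ?_
      fun s h1 h2 => ?_
    · simp only [fluidInput_eq]
      omega
    · have := hmono s h1 h2
      simp only [fluidInput_eq]
      omega
  · refine reflect_eq_of_down (z := fun s => fluidInput 𝔮 Ξp Ξm s ω) htt' hb hb' ?_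
      fun s h1 h2 => ?_
    · simp only [fluidInput_eq]
      omega
    · have := hmono s h1 h2
      simp only [fluidInput_eq]
      omega

lemma fluidPair_eq_of_proposals (h : IsFluidInput P q 𝔮 Ξp Ξm X₀) {t t' : ℝ≥0} (htt' : t ≤ t')
    (ω : Ω) :
    (proposals 𝔮 Ξp Ξm t t' ω = (0, 0) →
      fluidPair 𝔮 Ξp Ξm X₀ t' ω = fluidPair 𝔮 Ξp Ξm X₀ t ω) ∧
    (proposals 𝔮 Ξp Ξm t t' ω = (1, 0) → fluidPair 𝔮 Ξp Ξm X₀ t' ω =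
      ((fluidPair 𝔮 Ξp Ξm X₀ t ω).1, (fluidPair 𝔮 Ξp Ξm X₀ t ω).2 + 1)) ∧
    (proposals 𝔮 Ξp Ξm t t' ω = (0, 1) → fluidPair 𝔮 Ξp Ξm X₀ t' ω =
      ((fluidPair 𝔮 Ξp Ξm X₀ t ω).1, (fluidPair 𝔮 Ξp Ξm X₀ t ω).2 - 1)) := by
  obtain ⟨h1, h2, h3⟩ := h.fluidProcess_eq_of_proposals htt' ω
  have h0 := h.fluidProcess_nonneg t ω
  simp only [fluidPair, Prod.mk.injEq, true_and]
  refine ⟨fun hp => by rw [h1 hp], fun hp => ?_, fun hp => ?_⟩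
  · rw [h2 hp]
    omega
  · rw [h3 hp]
    omega

variable [IsProbabilityMeasure P]

lemma norm_fluidLaw_le (h : IsFluidInput P q 𝔮 Ξp Ξm X₀) (t : ℝ≥0) :
    ‖fluidLaw P 𝔮 Ξp Ξm X₀ t‖ ≤ 1 :=
  (norm_lawOn_le (h.measurable_fluidPair t)).trans measureReal_le_one

/-- The joint law solves the forward equation to first order. -/
lemma norm_fluidLaw_sub_sub_le (h : IsFluidInput P q 𝔮 Ξp Ξm X₀) {t t' : ℝ≥0} (htt' : t ≤ t') :
    ‖fluidLaw P 𝔮 Ξp Ξm X₀ t' - fluidLaw P 𝔮 Ξp Ξm X₀ t -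
      ((t' : ℝ) - t) • drift (1 - 𝔮 t 0) (fluidLaw P 𝔮 Ξp Ξm X₀ t)‖ ≤ 24 * ((t' : ℝ) - t) ^ 2 := by
  set Y := fluidPair 𝔮 Ξp Ξm X₀ t
  set Y' := fluidPair 𝔮 Ξp Ξm X₀ t'
  have hY : Measurable Y := h.measurable_fluidPair t
  have hY' : Measurable Y' := h.measurable_fluidPair t'
  set E : ℕ × ℕ → Set Ω := fun a => proposals 𝔮 Ξp Ξm t t' ⁻¹' {a} with hE
  have hEm (a : ℕ × ℕ) : MeasurableSet (E a) :=
    h.measurable_proposals t t' (measurableSet_singleton a)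
  have hEd {a b : ℕ × ℕ} (hab : a ≠ b) : Disjoint (E a) (E b) :=
    Disjoint.preimage _ (Set.disjoint_singleton.2 hab)
  -- On `U` there is at most one proposal and its effect is known exactly; by `b0` below, the
  -- complement has probability at most 4d².
  set U := E (0, 0) ∪ E (1, 0) ∪ E (0, 1) with hU
  have hd2 : Disjoint (E (0, 0) ∪ E (1, 0)) (E (0, 1)) :=
    Disjoint.union_left (hEd (by simp)) (hEd (by simp))
  have hUm : MeasurableSet U := ((hEm _).union (hEm _)).union (hEm _)
  set w := fluidLaw P 𝔮 Ξp Ξm X₀ t with hw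
  have hw1 : ‖w‖ ≤ 1 := h.norm_fluidLaw_le t
  have hlaw (a : ℕ × ℕ) : lawOn P Y (E a) = P.real (E a) • w :=
    lawOn_eq_smul hY fun x => h.measureReal_fluidPair_inter htt' x {a}
  have hsplit : fluidLaw P 𝔮 Ξp Ξm X₀ t' = P.real (E (0, 0)) • w +
      P.real (E (1, 0)) • (w + ZeroRange.birth ℕ w) + P.real (E (0, 1)) •
          (w + ZeroRange.death ℕ w) +
        lawOn P Y' Uᶜ := by
    have h1 : fluidLaw P 𝔮 Ξp Ξm X₀ t' = lawOn P Y' (U ∪ Uᶜ) := by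
      rw [Set.union_compl_self]
      rfl
    rw [h1, lawOn_union hY' hUm.compl disjoint_compl_right, hU, lawOn_union hY' (hEm _) hd2,
      lawOn_union hY' (hEm _) (hEd (by simp)),
      lawOn_congr (E := E (0, 0)) hY hY' fun ω hω => (h.fluidPair_eq_of_proposals htt' ω).1 hω,
      lawOn_up (E := E (1, 0)) hY hY' fun ω hω => (h.fluidPair_eq_of_proposals htt' ω).2.1 hω,
      lawOn_down hY hY' (hEm _) fun ω hω => (h.fluidPair_eq_of_proposals htt' ω).2.2 hω,
      hlaw, hlaw, hlaw, map_smul, map_smul, ← smul_add, ← smul_add]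
  set x : ℝ := (fluidClock 𝔮 t' : ℝ) - fluidClock 𝔮 t with hx
  set d : ℝ := (t' : ℝ) - t with hd
  have hx0 : 0 ≤ x := sub_nonneg.2 (by exact_mod_cast h.sol.fluidClock_mono htt')
  have hxd : x ≤ d := h.sol.fluidClock_sub_le htt'
  have hxc : |x - d * (1 - 𝔮 t 0)| ≤ 4 * d ^ 2 := h.sol.abs_fluidClock_sub_sub_le htt'
  have hxcoe : ((fluidClock 𝔮 t' - fluidClock 𝔮 t : ℝ≥0) : ℝ) = x :=
    NNReal.coe_sub (h.sol.fluidClock_mono htt')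
  have hdcoe : ((t' - t : ℝ≥0) : ℝ) = d := NNReal.coe_sub htt'
  have hp (a b : ℕ) := h.measureReal_proposals htt' a b
  simp only [poissonMeasure_real_singleton, hxcoe, hdcoe] at hp
  have hp0 : P.real (E (0, 0)) = Real.exp (-x) * Real.exp (-d) := by
    rw [hE]
    simp only
    rw [hp]
    simp
  have hp1 : P.real (E (1, 0)) = Real.exp (-x) * x * Real.exp (-d) := by
    rw [hE]
    simp only
    rw [hp]
    simp
  have hp2 : P.real (E (0, 1)) = Real.exp (-x) * (Real.exp (-d) * d) := by
    rw [hE]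
    simp only
    rw [hp]
    simp
  have hpU : P.real Uᶜ = 1 - (P.real (E (0, 0)) + P.real (E (1, 0)) + P.real (E (0, 1))) := by
    rw [probReal_compl_eq_one_sub hUm, hU, measureReal_union hd2 (hEm _),
      measureReal_union (hEd (by simp)) (hEm _)]
  obtain ⟨b0, b1, b2⟩ := poisson_one_step hx0 hxd hxc
  rw [← hp0, ← hp1, ← hp2] at b0
  rw [← hp1] at b1
  rw [← hp2] at b2
  rw [← hpU] at b0
  -- The four remainders are bounded by 4d², 4d², 12d² and 4d², which gives the constant 24.
  have hfin : fluidLaw P 𝔮 Ξp Ξm X₀ t' - w - d • drift (1 - 𝔮 t 0) w =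
      lawOn P Y' Uᶜ - P.real Uᶜ • w + (P.real (E (1, 0)) - d * (1 - 𝔮 t 0)) • ZeroRange.birth ℕ w +
        (P.real (E (0, 1)) - d) • ZeroRange.death ℕ w := by
    rw [hsplit, hpU, drift]
    module
  rw [hfin]
  have n1 : ‖lawOn P Y' Uᶜ‖ ≤ 4 * d ^ 2 := (norm_lawOn_le hY').trans b0
  have n2 : ‖P.real Uᶜ • w‖ ≤ 4 * d ^ 2 * 1 := by
    rw [norm_smul, Real.norm_of_nonneg measureReal_nonneg]
    gcongr
  have n3 : ‖(P.real (E (1, 0)) - d * (1 - 𝔮 t 0)) • ZeroRange.birth ℕ w‖ ≤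
      6 * d ^ 2 * (2 * 1) := by
    rw [norm_smul]
    gcongr
    · exact b1
    · exact (norm_birth_le w).trans (by gcongr)
  have n4 : ‖(P.real (E (0, 1)) - d) • ZeroRange.death ℕ w‖ ≤ 2 * d ^ 2 * (2 * 1) := by
    rw [norm_smul]
    gcongr
    · exact b2
    · exact (norm_death_le w).trans (by gcongr)
  refine (norm_add₃_le).trans ?_
  linarith [norm_sub_le (lawOn P Y' Uᶜ) (P.real Uᶜ • w)]

lemma jointLaw_eq (h : IsFluidInput P q 𝔮 Ξp Ξm X₀) (t : ℝ≥0) (x : ℕ × ℕ) :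
    jointLaw P (fluidProcess 𝔮 Ξp Ξm X₀) t x = fluidLaw P 𝔮 Ξp Ξm X₀ t x := by
  rw [fluidLaw, lawOn_apply (h.measurable_fluidPair t), jointLaw, Set.inter_univ]
  congr 1
  ext ω
  have := h.fluidProcess_nonneg t ω
  simp only [Set.mem_ofPred_eq, h.fluidProcess_zero, Set.mem_preimage, Set.mem_singleton_iff,
    fluidPair, Prod.ext_iff]
  omega

lemma fluidLaw_zero_apply (h : IsFluidInput P q 𝔮 Ξp Ξm X₀) (x : ℕ × ℕ) :
    fluidLaw P 𝔮 Ξp Ξm X₀ 0 x = if x.1 = x.2 then q x.1 else 0 := by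
  rw [fluidLaw, lawOn_apply (h.measurable_fluidPair 0), Set.inter_univ, ← h.law]
  split_ifs with hx
  · congr 1
    ext ω
    simp only [Set.mem_preimage, Set.mem_singleton_iff, fluidPair, h.fluidProcess_zero,
      Int.toNat_natCast, Prod.ext_iff, Set.mem_ofPred_eq]
    omega
  · have : fluidPair 𝔮 Ξp Ξm X₀ 0 ⁻¹' {x} = ∅ := by
      ext ω
      simp only [Set.mem_preimage, Set.mem_singleton_iff, fluidPair, h.fluidProcess_zero,
        Int.toNat_natCast, Prod.ext_iff, Set.mem_empty_iff_false, iff_false]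
      omega
    rw [this, measureReal_empty]

/-- Uniform tightness of the joint laws on compact time intervals. -/
lemma exists_sum_fluidLaw_gt (h : IsFluidInput P q 𝔮 Ξp Ξm X₀) (T : ℝ≥0) {δ : ℝ} (hδ : 0 < δ) :
    ∃ s : Finset (ℕ × ℕ), ∀ t ≤ T, 1 - δ < ∑ x ∈ s, fluidLaw P 𝔮 Ξp Ξm X₀ t x := by
  -- Deaths only lower the process, so X(0) plus all births proposed up to T dominates X(t) for
  -- every t ≤ T simultaneously.
  set B : ℕ → Set Ω := fun K => {ω | X₀ ω + Ξp (fluidClock 𝔮 T) ω ≤ K} with hB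
  have hBmono : Monotone B := fun K L hKL ω hω => le_trans (show X₀ ω + _ ≤ K from hω) hKL
  have hBU : ⋃ K, B K = Set.univ := Set.eq_univ_of_forall fun ω =>
    Set.mem_iUnion.2 ⟨_, le_refl (X₀ ω + Ξp (fluidClock 𝔮 T) ω)⟩
  have hlim : Tendsto (fun K => P.real (B K)) atTop (𝓝 1) := by
    have h1 := tendsto_measure_iUnion_atTop (μ := P) hBmono
    rw [hBU, measure_univ] at h1
    exact (ENNReal.tendsto_toReal ENNReal.one_ne_top).comp h1
  obtain ⟨K, hK⟩ := (hlim.eventually_const_lt (by linarith : 1 - δ < 1)).exists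
  refine ⟨Finset.range (K + 1) ×ˢ Finset.range (K + 1), fun t htT => hK.trans_le ?_⟩
  have hY := h.measurable_fluidPair t
  have h1 (x : ℕ × ℕ) : fluidLaw P 𝔮 Ξp Ξm X₀ t x =
      ((P.restrict Set.univ).map (fluidPair 𝔮 Ξp Ξm X₀ t)).real {x} := rfl
  simp_rw [h1]
  rw [sum_measureReal_singleton, map_measureReal_apply hY (Finset.measurableSet _),
    Measure.restrict_univ]
  refine measureReal_mono fun ω (hω : X₀ ω + Ξp (fluidClock 𝔮 T) ω ≤ K) => ?_
  have h2 : fluidProcess 𝔮 Ξp Ξm X₀ t ω ≤ X₀ ω + Ξp (fluidClock 𝔮 T) ω := by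
    rw [fluidProcess_eq, reflect_le_iff (z := fun s => fluidInput 𝔮 Ξp Ξm s ω)
      (h.fluidInput_sub_le ω htT)]
    have h3 := h.fluidInput_sub_le ω htT
    refine ⟨?_, fun s hs => by linarith [h3 s hs, Int.natCast_nonneg (X₀ ω)]⟩
    have h4 := h3 0 zero_le
    have h5 : fluidInput 𝔮 Ξp Ξm 0 ω = 0 := by
      rw [fluidInput_eq, fluidClock_zero, h.birth.zero, h.death.zero]
      rfl
    linarith
  simp only [Set.mem_preimage, Finset.coe_product, Finset.coe_range, Set.mem_prod, Set.mem_Iio,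
    fluidPair]
  omega

end IsFluidInput

end

/-! ### The discrepancy, and the passage from ℓ² to ℓ¹ -/

section

variable {n m : ℕ}

lemma continuous_of_norm_sub_le {E : Type*} [SeminormedAddCommGroup E] {f : ℝ≥0 → E} {a b : ℝ}
    (h : ∀ s t : ℝ≥0, s ≤ t → ‖f t - f s‖ ≤ a * ((t : ℝ) - s) + b * ((t : ℝ) - s) ^ 2) :
    Continuous f := by
  refine continuous_iff_continuousAt.2 fun t => ?_
  rw [ContinuousAt, tendsto_iff_norm_sub_tendsto_zero]
  have h1 (s : ℝ≥0) : ‖f s - f t‖ ≤ a * |(s : ℝ) - t| + b * |(s : ℝ) - t| ^ 2 := by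
    rcases le_total t s with hst | hst
    · rw [abs_of_nonneg (sub_nonneg.2 (by exact_mod_cast hst))]
      exact h t s hst
    · rw [abs_sub_comm, abs_of_nonneg (sub_nonneg.2 (by exact_mod_cast hst)), norm_sub_rev]
      exact h s t hst
  have h2 : Continuous fun s : ℝ≥0 => a * |(s : ℝ) - t| + b * |(s : ℝ) - t| ^ 2 := by fun_prop
  have h3 := h2.tendsto t
  simp only [sub_self, abs_zero, mul_zero, ne_eq, OfNat.ofNat_ne_zero, not_false_eq_true, zero_pow,
    add_zero] at h3
  exact squeeze_zero (fun _ => norm_nonneg _) h1 h3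

/-- The squared distance of the empirical quantities of the configuration `x` from their fluid
counterparts at time `t`. -/
def discrepancy {Ω : Type*} [MeasurableSpace Ω] (P : Measure Ω) [IsProbabilityMeasure P]
    (𝔮 : ℝ → ℕ → ℝ) (Ξp Ξm : ℝ≥0 → Ω → ℕ) (X₀ : Ω → ℕ) (η₀ : Config n m) (t : ℝ≥0)
    (x : Config n m) : ℝ :=
  ‖occupation η₀.1 x.1 - fluidLaw P 𝔮 Ξp Ξm X₀ t‖ ^ 2 +
    ‖occupation (fun _ => ()) x.1 - toProfile (𝔮 t)‖ ^ 2

lemma l1dist_le_ofReal {α : Type*} {x y : α → ℝ} {C : ℝ}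
    (h : ∀ s : Finset α, ∑ a ∈ s, |x a - y a| ≤ C) : l1dist x y ≤ ENNReal.ofReal C := by
  rw [l1dist, ENNReal.tsum_eq_iSup_sum]
  refine iSup_le fun s => ?_
  simp_rw [Real.enorm_eq_ofReal_abs]
  rw [← ENNReal.ofReal_sum_of_nonneg fun _ _ => abs_nonneg _]
  exact ENNReal.ofReal_le_ofReal (h s)

lemma sum_abs_le_toReal_l1dist {α : Type*} {x y : α → ℝ} (h : l1dist x y ≠ ⊤) (s : Finset α) :
    ∑ a ∈ s, |x a - y a| ≤ (l1dist x y).toReal := by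
  rw [← ENNReal.ofReal_le_iff_le_toReal h, ENNReal.ofReal_sum_of_nonneg fun _ _ => abs_nonneg _]
  simp_rw [← Real.enorm_eq_ofReal_abs]
  exact ENNReal.sum_le_tsum s

/-- A quantitative form of Scheffé's lemma. -/
lemma sum_abs_sub_le {α : Type*} {x y : α → ℝ} (hx0 : ∀ a, 0 ≤ x a) (hy0 : ∀ a, 0 ≤ y a)
    (hx : ∀ s : Finset α, ∑ a ∈ s, x a ≤ 1) (hy : ∀ s : Finset α, ∑ a ∈ s, y a ≤ 1)
    (s u : Finset α) :
    ∑ a ∈ u, |x a - y a| ≤ 2 * ∑ a ∈ s, |x a - y a| + 2 * (1 - ∑ a ∈ s, y a) := by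
  classical
  have h1 : ∑ a ∈ u, |x a - y a| ≤ ∑ a ∈ s, |x a - y a| + ∑ a ∈ u \ s, |x a - y a| := by
    rw [← Finset.sum_union Finset.disjoint_sdiff, Finset.union_sdiff_self_eq_union]
    exact Finset.sum_le_sum_of_subset_of_nonneg Finset.subset_union_right
      fun _ _ _ => abs_nonneg _
  have h2 : ∑ a ∈ u \ s, |x a - y a| ≤ ∑ a ∈ u \ s, x a + ∑ a ∈ u \ s, y a := by
    rw [← Finset.sum_add_distrib]
    refine Finset.sum_le_sum fun a _ => ?_
    rw [abs_le]
    constructor <;> linarith [hx0 a, hy0 a]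
  -- Outside s, y has mass at most 1 - ∑ y, and x at most the same plus the ℓ¹ distance on s.
  have h3 := hx (s ∪ u \ s)
  have h4 := hy (s ∪ u \ s)
  rw [Finset.sum_union Finset.disjoint_sdiff] at h3 h4
  have h5 : ∑ a ∈ s, y a - ∑ a ∈ s, x a ≤ ∑ a ∈ s, |x a - y a| := by
    rw [← Finset.sum_sub_distrib]
    exact Finset.sum_le_sum fun a _ => by linarith [neg_abs_le (x a - y a)]
  linarith

section occupation

variable {α : Type*} [DecidableEq α]

lemma occupation_nonneg (a : Fin n → α) (x : Fin n → ℕ) (y : α × ℕ) : 0 ≤ occupation a x y := by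
  rw [occupation_apply]
  refine mul_nonneg (by positivity) (Finset.sum_nonneg fun i _ => ?_)
  split_ifs <;> norm_num

lemma sum_occupation_le_one (a : Fin n → α) (x : Fin n → ℕ) (s : Finset (α × ℕ)) :
    ∑ y ∈ s, occupation a x y ≤ 1 := by
  simp_rw [occupation_apply]
  rw [← Finset.mul_sum, Finset.sum_comm, one_div]
  refine inv_mul_le_one_of_le₀ ?_ (by positivity)
  calc ∑ i, ∑ y ∈ s, (if y = (a i, x i) then (1 : ℝ) else 0) ≤ ∑ _i : Fin n, (1 : ℝ) :=
        Finset.sum_le_sum fun i _ => by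
          rw [Finset.sum_ite_eq']
          split_ifs <;> norm_num
    _ = n := by simp

lemma empirical_apply (x : Fin n → α) (a : α) :
    empirical x a = (1 / (n : ℝ)) * ∑ i, if a = x i then (1 : ℝ) else 0 := by
  rw [empirical, Pi.smul_apply, Finset.sum_apply, smul_eq_mul]
  simp_rw [Pi.single_apply]

end occupation

lemma transitionMatrix_apply (η η' : Config n m) (x : ℕ × ℕ) :
    transitionMatrix η η' x = occupation η.1 η'.1 x := by
  rw [transitionMatrix, empirical_apply, occupation_apply]

lemma occupation_unit_apply (x : Fin n → ℕ) (y : Unit × ℕ) :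
    occupation (fun _ => ()) x y = empirical x y.2 := by
  rw [occupation_apply, empirical_apply]
  simp [Prod.ext_iff]

lemma occupation_self_apply (x : Fin n → ℕ) (y : ℕ × ℕ) :
    occupation x x y = if y.1 = y.2 then empirical x y.1 else 0 := by
  rw [occupation_apply, empirical_apply]
  split_ifs with h
  · simp only [Prod.ext_iff, ← h, and_self]
  · rw [Finset.sum_eq_zero, mul_zero]
    intro i _
    rw [if_neg]
    rintro rfl
    exact h rfl

namespace IsFluidInput

variable {Ω : Type*} [MeasurableSpace Ω] {P : Measure Ω} {q : ℕ → ℝ}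
  {𝔮 : ℝ → ℕ → ℝ} {Ξp Ξm : ℝ≥0 → Ω → ℕ} {X₀ : Ω → ℕ}

lemma abs_one_sub_le_one (h : IsFluidInput P q 𝔮 Ξp Ξm X₀) (t : ℝ≥0) : |1 - 𝔮 t 0| ≤ 1 := by
  have := h.sol.isProb t t.coe_nonneg
  exact abs_one_sub_le (this.1 0) (this.le_one 0)

lemma continuous_toProfile (h : IsFluidInput P q 𝔮 Ξp Ξm X₀) :
    Continuous fun t : ℝ≥0 => toProfile (𝔮 t) :=
  continuous_of_norm_sub_le (a := 4) (b := 0) fun s t hst => by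
    linarith [h.sol.norm_sub_le s.coe_nonneg (show (s : ℝ) ≤ t by exact_mod_cast hst)]

lemma norm_toProfile_le (h : IsFluidInput P q 𝔮 Ξp Ξm X₀) (t : ℝ≥0) : ‖toProfile (𝔮 t)‖ ≤ 1 :=
  (h.sol.isProb t t.coe_nonneg).norm_toProfile_le

variable [IsProbabilityMeasure P]

lemma fluidLaw_nonneg (h : IsFluidInput P q 𝔮 Ξp Ξm X₀) (t : ℝ≥0) (x : ℕ × ℕ) :
    0 ≤ fluidLaw P 𝔮 Ξp Ξm X₀ t x := by
  rw [← h.jointLaw_eq]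
  exact measureReal_nonneg

lemma sum_fluidLaw_le_one (h : IsFluidInput P q 𝔮 Ξp Ξm X₀) (t : ℝ≥0) (s : Finset (ℕ × ℕ)) :
    ∑ x ∈ s, fluidLaw P 𝔮 Ξp Ξm X₀ t x ≤ 1 := by
  have hY := h.measurable_fluidPair t
  have h1 (x : ℕ × ℕ) : fluidLaw P 𝔮 Ξp Ξm X₀ t x =
      ((P.restrict Set.univ).map (fluidPair 𝔮 Ξp Ξm X₀ t)).real {x} := rfl
  simp_rw [h1]
  rw [sum_measureReal_singleton, map_measureReal_apply hY (Finset.measurableSet _),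
    Measure.restrict_univ]
  exact measureReal_le_one

lemma continuous_fluidLaw (h : IsFluidInput P q 𝔮 Ξp Ξm X₀) :
    Continuous (fluidLaw P 𝔮 Ξp Ξm X₀) := by
  refine continuous_of_norm_sub_le (a := 4) (b := 24) fun s t hst => ?_
  have h0 : 0 ≤ (t : ℝ) - s := sub_nonneg.2 (by exact_mod_cast hst)
  have h1 := h.norm_fluidLaw_sub_sub_le hst
  have h2 := norm_drift_le (h.abs_one_sub_le_one s) (fluidLaw P 𝔮 Ξp Ξm X₀ s)
  have h3 := h.norm_fluidLaw_le s
  have h4 : ‖((t : ℝ) - s) • drift (1 - 𝔮 s 0) (fluidLaw P 𝔮 Ξp Ξm X₀ s)‖ ≤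
      ((t : ℝ) - s) * 4 := by
    rw [norm_smul, Real.norm_of_nonneg h0]
    gcongr
    linarith
  have h5 := norm_le_norm_sub_add (fluidLaw P 𝔮 Ξp Ξm X₀ t - fluidLaw P 𝔮 Ξp Ξm X₀ s)
    (((t : ℝ) - s) • drift (1 - 𝔮 s 0) (fluidLaw P 𝔮 Ξp Ξm X₀ s))
  linarith

lemma continuous_discrepancy (h : IsFluidInput P q 𝔮 Ξp Ξm X₀) (η₀ x : Config n m) :
    Continuous fun t => discrepancy P 𝔮 Ξp Ξm X₀ η₀ t x := by
  have h1 := h.continuous_fluidLaw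
  have h2 := h.continuous_toProfile
  unfold discrepancy
  fun_prop

lemma discrepancy_le (h : IsFluidInput P q 𝔮 Ξp Ξm X₀) (η₀ : Config n m) (t : ℝ≥0)
    (x : Config n m) : discrepancy P 𝔮 Ξp Ξm X₀ η₀ t x ≤ 8 := by
  have h1 : ‖occupation η₀.1 x.1 - fluidLaw P 𝔮 Ξp Ξm X₀ t‖ ≤ 2 :=
    (norm_sub_le _ _).trans (by linarith [norm_occupation_le η₀.1 x.1, h.norm_fluidLaw_le t])
  have h2 : ‖occupation (fun _ => ()) x.1 - toProfile (𝔮 t)‖ ≤ 2 :=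
    (norm_sub_le _ _).trans
      (by linarith [norm_occupation_le (fun _ => ()) x.1, h.norm_toProfile_le t])
  rw [discrepancy]
  nlinarith [norm_nonneg (occupation η₀.1 x.1 - fluidLaw P 𝔮 Ξp Ξm X₀ t),
    norm_nonneg (occupation (fun _ => ()) x.1 - toProfile (𝔮 t))]

/-- The drift of the discrepancy is at most a multiple of itself, up to a small error. -/
lemma discrepancy_add_generator_le (h : IsFluidInput P q 𝔮 Ξp Ξm X₀) (hn : 0 < n)
    (η₀ : Config n m) (t s : ℝ≥0) (x : Config n m) (hs : s ≤ 1) :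
    discrepancy P 𝔮 Ξp Ξm X₀ η₀ (t + s) x +
        s * generator n m (discrepancy P 𝔮 Ξp Ξm X₀ η₀ (t + s)) x ≤
      (1 + 14 * s) * discrepancy P 𝔮 Ξp Ξm X₀ η₀ t x + 64 / n * s + 2208 * (s : ℝ) ^ 2 := by
  have hts : t ≤ t + s := le_self_add
  have hs1 : (s : ℝ) ≤ 1 := by exact_mod_cast hs
  have hsub : ((t + s : ℝ≥0) : ℝ) - t = s := by push_cast; ring
  have hp := h.sol.isProb t t.coe_nonneg
  have hw := h.norm_fluidLaw_sub_sub_le hts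
  have hQ := h.sol.norm_sub_sub_le t.coe_nonneg (show (t : ℝ) ≤ (t + s : ℝ≥0) by exact_mod_cast hts)
  rw [fluidField, toProfile_apply hp, hsub] at hQ
  rw [hsub] at hw
  have h1 := norm_sq_add_generator_le hn η₀.1 x (h.norm_fluidLaw_le t) (h.norm_fluidLaw_le (t + s))
    (h.abs_one_sub_le_one t) s.coe_nonneg hs1 (C := 24) (by norm_num) hw
  have h2 := norm_sq_add_generator_le hn (fun _ => ()) x (h.norm_toProfile_le t)
    (h.norm_toProfile_le (t + s)) (h.abs_one_sub_le_one t) s.coe_nonneg hs1 (by norm_num) hQ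
  -- The mismatch of birth rates is one coordinate of the unlabelled error; this closes the
  -- estimate.
  have h3 : (1 - emptyFraction x.1 - (1 - 𝔮 t 0)) ^ 2 ≤
      ‖occupation (fun _ => ()) x.1 - toProfile (𝔮 t)‖ ^ 2 := by
    have := Profile.abs_apply_le (occupation (fun _ => ()) x.1 - toProfile (𝔮 t)) ((), 0)
    rw [lp.coeFn_sub, Pi.sub_apply, toProfile_apply hp] at this
    rw [← sq_abs, show 1 - emptyFraction x.1 - (1 - 𝔮 t 0) =
      -(occupation (fun _ => ()) x.1 ((), 0) - 𝔮 t 0) by rw [emptyFraction]; ring, abs_neg]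
    gcongr
  have h4 : generator n m (discrepancy P 𝔮 Ξp Ξm X₀ η₀ (t + s)) x =
      generator n m (fun η => ‖occupation η₀.1 η.1 - fluidLaw P 𝔮 Ξp Ξm X₀ (t + s)‖ ^ 2) x +
      generator n m (fun η =>
        ‖occupation (fun _ => ()) η.1 - toProfile (𝔮 ((t + s : ℝ≥0) : ℝ))‖ ^ 2) x := by
    rw [← Pi.add_apply, ← map_add]
    rfl
  rw [h4, discrepancy, discrepancy]
  have h5 : (s : ℝ) * (1 - emptyFraction x.1 - (1 - 𝔮 t 0)) ^ 2 ≤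
      s * ‖occupation (fun _ => ()) x.1 - toProfile (𝔮 t)‖ ^ 2 :=
    mul_le_mul_of_nonneg_left h3 s.coe_nonneg
  have h6 : 0 ≤ (s : ℝ) * ‖occupation η₀.1 x.1 - fluidLaw P 𝔮 Ξp Ξm X₀ t‖ ^ 2 := by positivity
  have h7 : (64 : ℝ) / n * s = 2 * (32 / n * s) := by ring
  -- The labelled and unlabelled estimates give 10 and 10 on their own errors plus 2 + 2 on the
  -- unlabelled one, hence 14; 2208 is twice C² + 20C + 48 at C = 24.
  nlinarith

/-- The initial discrepancy is controlled by the distance of the initial distributions. -/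
lemma discrepancy_zero_le (h : IsFluidInput P q 𝔮 Ξp Ξm X₀) (hq : IsProb q) (η₀ : Config n m)
    (hd : l1dist (empirical η₀.1) q ≠ ⊤) :
    discrepancy P 𝔮 Ξp Ξm X₀ η₀ 0 η₀ ≤ 2 * (l1dist (empirical η₀.1) q).toReal ^ 2 := by
  set r := (l1dist (empirical η₀.1) q).toReal
  have hr := sum_abs_le_toReal_l1dist hd
  have h1 : ‖occupation η₀.1 η₀.1 - fluidLaw P 𝔮 Ξp Ξm X₀ 0‖ ≤ r := by
    refine Profile.norm_le_of_sum_abs_le fun s => ?_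
    have h3 (x : ℕ × ℕ) : |(occupation η₀.1 η₀.1 - fluidLaw P 𝔮 Ξp Ξm X₀ 0) x| =
        if x.1 = x.2 then |empirical η₀.1 x.1 - q x.1| else 0 := by
      rw [lp.coeFn_sub, Pi.sub_apply, occupation_self_apply, h.fluidLaw_zero_apply]
      split_ifs <;> simp
    simp_rw [h3]
    rw [← Finset.sum_filter]
    refine le_of_eq_of_le ?_ (hr ((s.filter fun x => x.1 = x.2).image Prod.fst))
    rw [Finset.sum_image]
    intro x hx y hy hxy
    have hx' := (Finset.mem_filter.1 (Finset.mem_coe.1 hx)).2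
    have hy' := (Finset.mem_filter.1 (Finset.mem_coe.1 hy)).2
    exact Prod.ext hxy (by rw [← hx', ← hy', hxy])
  have h2 : ‖occupation (fun _ => ()) η₀.1 - toProfile (𝔮 (0 : ℝ≥0))‖ ≤ r := by
    refine Profile.norm_le_of_sum_abs_le fun s => ?_
    have h3 (x : Unit × ℕ) :
        |(occupation (fun _ => ()) η₀.1 - toProfile (𝔮 (0 : ℝ≥0))) x| =
          |empirical η₀.1 x.2 - q x.2| := by
      rw [NNReal.coe_zero, h.sol.initial, lp.coeFn_sub, Pi.sub_apply, occupation_unit_apply,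
        toProfile_apply hq]
    simp_rw [h3]
    refine le_of_eq_of_le ?_ (hr (s.image Prod.snd))
    rw [Finset.sum_image]
    exact fun x _ y _ hxy => Prod.ext rfl hxy
  rw [discrepancy, two_mul]
  gcongr

/-- A small discrepancy forces a small `ℓ¹` distance, uniformly on compact time intervals. -/
lemma exists_l1dist_le (h : IsFluidInput P q 𝔮 Ξp Ξm X₀) (T : ℝ≥0) {ε : ℝ} (hε : 0 < ε) :
    ∃ a > 0, ∀ (n m : ℕ) (η₀ : Config n m) (x : Config n m), ∀ t ≤ T,
      discrepancy P 𝔮 Ξp Ξm X₀ η₀ t x ≤ a →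
      l1dist (transitionMatrix η₀ x) (jointLaw P (fluidProcess 𝔮 Ξp Ξm X₀) t) ≤
        ENNReal.ofReal ε := by
  obtain ⟨s, hs⟩ := h.exists_sum_fluidLaw_gt T (show 0 < ε / 4 by positivity)
  -- By Cauchy–Schwarz this makes the ℓ¹ distance on s at most ε/4; Scheffé then gives 2 · ε/4 + 2 ·
  -- ε/4. The + 1 allows s to be empty.
  refine ⟨(ε / 4) ^ 2 / (s.card + 1), by positivity, fun n m η₀ x t ht hx => ?_⟩
  refine l1dist_le_ofReal fun u => ?_
  simp_rw [transitionMatrix_apply, h.jointLaw_eq]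
  refine (sum_abs_sub_le (occupation_nonneg _ _) (h.fluidLaw_nonneg t)
    (sum_occupation_le_one _ _) (h.sum_fluidLaw_le_one t) s u).trans ?_
  set D := occupation η₀.1 x.1 - fluidLaw P 𝔮 Ξp Ξm X₀ t with hD
  have h1 : ∑ y ∈ s, |occupation η₀.1 x.1 y - fluidLaw P 𝔮 Ξp Ξm X₀ t y| ≤ ε / 4 := by
    refine abs_le_of_sq_le_sq' ?_ (by positivity) |>.2
    have h2 : ‖D‖ ^ 2 ≤ (ε / 4) ^ 2 / (s.card + 1) :=
      (le_add_of_nonneg_right (sq_nonneg _)).trans hx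
    calc (∑ y ∈ s, |D y|) ^ 2 ≤ s.card * ∑ y ∈ s, |D y| ^ 2 := sq_sum_le_card_mul_sum_sq
      _ = s.card * ∑ y ∈ s, D y ^ 2 := by simp_rw [sq_abs]
      _ ≤ (s.card + 1) * ((ε / 4) ^ 2 / (s.card + 1)) := by
          gcongr
          · linarith
          · exact (Profile.sum_sq_le D s).trans h2
      _ = (ε / 4) ^ 2 := by field_simp
  linarith [hs t ht]

end IsFluidInput

end

end

end ZeroRange

theorem proposition7
    -- the systems: the `j`-th one has `n j` sites and `m j` particles, initially arranged as `η₀ j`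
    (n m : ℕ → ℕ) (hn : ∀ j, 0 < n j)
    (η₀ : ∀ j, ZeroRange.Config (n j) (m j))
    {Ω : ℕ → Type*} [∀ j, MeasurableSpace (Ω j)]
    (P : ∀ j, Measure (Ω j)) [∀ j, IsProbabilityMeasure (P j)]
    (η : ∀ j, ℝ≥0 → Ω j → ZeroRange.Config (n j) (m j))
    (hη : ∀ j, ZeroRange.IsZeroRangeProcess (P j) (η j) (η₀ j))
    -- the regime `n → ∞`, `m / n → ρ`
    (ρ : ℝ) (hρ : 0 < ρ)
    (hn_lim : Tendsto n atTop atTop)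
    (hm_lim : Tendsto (fun j => (m j : ℝ) / (n j : ℝ)) atTop (𝓝 ρ))
    -- the initial empirical distribution tends to `q` in `ℓ¹`
    (q : ℕ → ℝ) (hq : ZeroRange.IsProb q)
    (hq_lim : Tendsto (fun j => ZeroRange.l1dist (ZeroRange.empirical (η₀ j).1) q) atTop (𝓝 0))
    -- the ingredients of the fluid process: two Poisson processes and a `q`-distributed variable,
    -- all independent
    {Ω' : Type*} [MeasurableSpace Ω'] (P' : Measure Ω') [IsProbabilityMeasure P']
    (Ξp Ξm : ℝ≥0 → Ω' → ℕ) (X₀ : Ω' → ℕ)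
    (hΞp : ZeroRange.IsUnitPoissonProcess P' Ξp) (hΞm : ZeroRange.IsUnitPoissonProcess P' Ξm)
    (hX₀ : Measurable X₀) (hX₀_law : ∀ k, P'.real {ω | X₀ ω = k} = q k)
    (hΞ_indep : IndepFun (fun ω t => Ξp t ω) (fun ω t => Ξm t ω) P')
    (hX₀_indep : IndepFun X₀ (fun ω => ((fun t => Ξp t ω), (fun t => Ξm t ω))) P') :
    -- there is a unique fluid limit `𝔮` started from `q`, and for the process `X` built from it,
    -- `W` converges to the joint law of `(X(0), X(t))`, uniformly on compacts in probability
    ∃ 𝔮 : ℝ → ℕ → ℝ, ZeroRange.IsFluidSolution q 𝔮 ∧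
      (∀ 𝔮', ZeroRange.IsFluidSolution q 𝔮' → ∀ t, 0 ≤ t → 𝔮' t = 𝔮 t) ∧
      ∀ T : ℝ≥0, ∀ ε : ℝ≥0∞, 0 < ε →
        Tendsto (fun j => P j {ω | ε ≤ ⨆ t ∈ Set.Icc 0 T,
            ZeroRange.l1dist (ZeroRange.transitionMatrix (η j 0 ω) (η j t ω))
              (ZeroRange.jointLaw P' (ZeroRange.fluidProcess 𝔮 Ξp Ξm X₀) t)})
          atTop (𝓝 0) := by
  obtain ⟨𝔮, h𝔮⟩ := ZeroRange.exists_isFluidSolution hq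
  refine ⟨𝔮, h𝔮, fun 𝔮' h𝔮' t ht => h𝔮.unique h𝔮' ht, fun T ε hε => ?_⟩
  have hX : ZeroRange.IsFluidInput P' q 𝔮 Ξp Ξm X₀ :=
    ⟨h𝔮, hΞp, hΞm, hX₀, hX₀_law, hΞ_indep, hX₀_indep⟩
  -- A finite ε' strictly below ε is needed, since ε may be infinite and the event is ε ≤ sup.
  obtain ⟨ε', hε'0, hε'⟩ := ENNReal.lt_iff_exists_nnreal_btwn.1 hε
  have hε'1 : (0 : ℝ) < ε' := by exact_mod_cast hε'0
  obtain ⟨a, ha, hl1⟩ := hX.exists_l1dist_le T hε'1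
  set r : ℕ → ℝ := fun j => (ZeroRange.l1dist (ZeroRange.empirical (η₀ j).1) q).toReal with hr
  have hr_lim : Tendsto r atTop (𝓝 0) :=
    (ENNReal.tendsto_toReal ENNReal.zero_ne_top).comp hq_lim
  have hbound : Tendsto (fun j => Real.exp (14 * T) * (2 * r j ^ 2 + 64 / (n j : ℝ) * T) / a)
      atTop (𝓝 0) := by
    have h1 : Tendsto (fun j => 64 / (n j : ℝ)) atTop (𝓝 0) :=
      (tendsto_natCast_atTop_atTop.comp hn_lim).const_div_atTop 64
    have h2 := ((((hr_lim.pow 2).const_mul 2).add (h1.mul_const (T : ℝ))).const_mul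
      (Real.exp (14 * T))).div_const a
    simpa using h2
  have hbound' := ENNReal.tendsto_ofReal hbound
  rw [ENNReal.ofReal_zero] at hbound'
  refine tendsto_of_tendsto_of_tendsto_of_le_of_le' tendsto_const_nhds hbound'
    (Eventually.of_forall fun _ => zero_le) ?_
  -- Eventually the initial distance is finite, so its real value `r j` carries the information.
  filter_upwards [hq_lim.eventually_lt_const ENNReal.zero_lt_top] with j hj
  set A : Set (Ω j) := {ω | ∃ t ≤ T, a < ZeroRange.discrepancy P' 𝔮 Ξp Ξm X₀ (η₀ j) t (η j t ω)}
  have hA : (P j).real A ≤ Real.exp (14 * T) * (2 * r j ^ 2 + 64 / (n j : ℝ) * T) / a := by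
    rw [le_div_iff₀ ha, mul_comm]
    refine ((hη j).maximal ha.le (by norm_num) (by positivity) (by norm_num)
      (fun t x => add_nonneg (sq_nonneg _) (sq_nonneg _)) (hX.discrepancy_le (η₀ j))
      (hX.continuous_discrepancy (η₀ j))
      (fun t s x hs => hX.discrepancy_add_generator_le (hn j) (η₀ j) t s x hs) T).trans ?_
    gcongr
    exact hX.discrepancy_zero_le hq (η₀ j) hj.ne
  refine (measure_mono_ae ?_).trans
    ((ENNReal.le_ofReal_iff_toReal_le (measure_ne_top _ A) (by positivity)).2 hA)
  -- W is built from `η j 0 ω` and the discrepancy from `η₀ j`; they agree almost surely.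
  -- Monotonicity of outer measure suffices, so the event of the statement need not be shown
  -- measurable.
  filter_upwards [(hη j).initial] with ω hω hmem
  by_contra hωA
  have hsup : (⨆ t ∈ Set.Icc 0 T,
      ZeroRange.l1dist (ZeroRange.transitionMatrix (η j 0 ω) (η j t ω))
        (ZeroRange.jointLaw P' (ZeroRange.fluidProcess 𝔮 Ξp Ξm X₀) t)) ≤ ENNReal.ofReal ε' := by
    refine iSup₂_le fun t ht => ?_
    rw [hω]
    exact hl1 _ _ _ _ t ht.2 (not_lt.1 fun hlt => hωA ⟨t, ht.2, hlt⟩)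
  rw [ENNReal.ofReal_coe_nnreal] at hsup
  exact absurd (le_trans hmem hsup) (not_le.2 hε')
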